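/- Let $\mathfrak{X}$ be a complex separable Hilbert space, let $B(\mathfrak{X})$ be the algebra of bounded linear operators on $\mathfrak{X}$ with the operator norm, and let $I$ be the identity operator. A Fredholm operator is an operator in $B(\mathfrak{X})$ with closed range, finite-dimensional kernel and range of finite codimension. For $z_0\in\mathbb{C}$, say that a function $G:\mathbb{C}\to B(\mathfrak{X})$ is of the form (P1) with centre $z_0$ if there are complex numbers $z_n\neq z_0$ ($n\ge 1$) with $|z_n|\to\infty$ and orthogonal projections $P_n\in B(\mathfrak{X})$ of finite rank ($P_n=0$ being allowed, so that finite products are included) such that $$G(z)=\lim_{n\to\infty}\ \prod_{k=1}^{n}\left[I-\frac{z-z_0}{z_k-z_0}P_k\right]\exp\left[\sum_{j=1}^{k}\frac1j\left(\frac{z-z_0}{z_k-z_0}\right)^{j}P_k\right],$$ where the factors are multiplied from left to right in the order $k=1,2,\dots,n$ and the limit exists in operator norm, uniformly for $z$ in every bounded subset of $\mathbb{C}$. Theorem 4.2. Let $A:\mathbb{C}\to B(\mathfrak{X})$ be an entire function such that $A(z)$ is a Fredholm operator for every $z\in\mathbb{C}$ and $A(z_0)$ is invertible for some $z_0\in\mathbb{C}$.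 Then there are entire functions $P,Q,E,F:\mathbb{C}\to B(\mathfrak{X})$ such that $$A(z)=P(z)E(z)=F(z)Q(z)\qquad\text{for all }z\in\mathbb{C},$$ where $P$ and $Q$ are both of the form (P1) with centre $z_0$ (in general with different sequences of points and projections), and $E(z)$ and $F(z)$ are invertible in $B(\mathfrak{X})$ for every $z\in\mathbb{C}$. -/

import Mathlib

open Filter Topology

noncomputable section

namespace OperatorWeierstrass

variable {X : Type*} [NormedAddCommGroup X] [InnerProductSpace ℂ X]

/-- The elementary factor `[I - w P] exp [w P + (w ^ 2 / 2) P + ⋯ + (w ^ n / n) P]`. -/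
def elementaryFactor (P : X →L[ℂ] X) (n : ℕ) (w : ℂ) : X →L[ℂ] X :=
  (1 - w • P) * NormedSpace.exp (∑ k ∈ Finset.Icc 1 n, (w ^ k / (k : ℂ)) • P)

/-- The ordered product of the first `n` elementary factors, each new factor being put on the
right. The sequences are indexed from `0`, so the `k`-th entry carries an exponential of
degree `k + 1`: the first factor has degree `1`, the second has degree `2`, and so on. -/
def partialProduct (z₀ : ℂ) (a : ℕ → ℂ) (P : ℕ → X →L[ℂ] X) : ℕ → ℂ → X →L[ℂ] X
  | 0, _ => 1
  | n + 1, z =>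
      partialProduct z₀ a P n z * elementaryFactor (P n) (n + 1) ((z - z₀) / (a n - z₀))

/-- `G` is an infinite product of elementary factors centred at `z₀`: there are complex numbers
`a n ≠ z₀` with `|a n| → ∞` and finite rank orthogonal projections `P n` (zero projections are
allowed, so finite products are included) such that the partial products converge to `G` in
operator norm, uniformly on every bounded set. -/
def IsWeierstrassProduct [CompleteSpace X] (z₀ : ℂ) (G : ℂ → X →L[ℂ] X) : Prop :=
  ∃ (a : ℕ → ℂ) (P : ℕ → X →L[ℂ] X),
    Tendsto (fun n => ‖a n‖) atTop atTop ∧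
    (∀ n, a n ≠ z₀) ∧
    (∀ n, IsStarProjection (P n)) ∧
    (∀ n, FiniteDimensional ℂ (P n).range) ∧
    ∀ S : Set ℂ, Bornology.IsBounded S → TendstoUniformlyOn (partialProduct z₀ a P) G atTop S

end OperatorWeierstrass

end

/-!
An elementary factor acts as a scalar Weierstrass factor on the range of its projection and as the
identity on the orthogonal complement, so canonical products converge, are entire, and are singular
only at their zeros, whatever the projections are (`exists_summable_bound`).

By the analytic Fredholm theorem the inverse of `A` is meromorphic on the plane
(`exists_hasInverseOrder`). Near a limit of points of invertibility, `A` is an invertible family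
plus a constant operator `ι κ` of finite rank, and its invertibility reduces to that of `1 + G ι κ`
with a holomorphic `G`, hence, as in Sylvester's determinant identity, to that of the finite matrix
`1 + κ G ι`. The orders of the poles of the inverse form a locally finite divisor
(`exists_divisor`).

*Zeros on the left.* Take the orthogonal projection onto the complement of the range of `A a`. The
corresponding elementary factor divides `A` on the left, and the inverse of the quotient has a pole
at `a` of smaller order (`exists_left_elementaryFactor`). Splitting off all zeros in an order in
which they tend to infinity gives quotients `A n` with `A = (partial product) * A n`. On a fixed
disc all factors from some index on are invertible and close to `1`, so the `A n` converge there to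
an invertible holomorphic function (`exists_eq_weierstrassProduct_mul`).

*Zeros on the right.* Passing to adjoints in the first part would put the factors in the reverse
order, each new factor on the left of the product. Instead a sequence of finite factorizations
`A = F * Q` on growing discs is constructed. To pass to a larger disc one splits off the new zeros
on the right, using the kernels (`exists_right_elementaryFactor`); this gives a block `T` with
`A = A' * T`. On the old disc `T` is as close to `1` as desired, because the degrees of its factors
may be taken large, and there `A' = F * Q * T⁻¹`. An elementary factor times a function close to `1`
equals a function close to `1` times an elementary factor with the same zero and a nearby
projection (`exists_elementaryFactor_mul_eq`), so that `Q * T⁻¹ = S * Q'` with `S` close to `1` and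
`Q'` close to `Q`. Hence `A = F' * (Q' * T)` with `F' = F * S` on the old disc
(`IsStage.exists_next`). With summable errors the projections and the quotients converge, which
gives the second factorization (`exists_eq_mul_weierstrassProduct`).
-/

noncomputable section

namespace OperatorWeierstrass

/-! ### Infinite ordered products in a Banach algebra -/

section OrderedProduct

variable {R : Type*} [NormedRing R]

/-- The product `u 0 * u 1 * ⋯ * u (n - 1)` in a possibly noncommutative ring, in this order. -/
def orderedProd (u : ℕ → R) : ℕ → R
  | 0 => 1
  | n + 1 => orderedProd u n * u n

/-- The infinite product `u 0 * u 1 * ⋯`, written as a telescoping series; see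
`tendstoUniformlyOn_orderedProd`. -/
def infiniteProd (u : ℕ → R) : R :=
  1 + ∑' i, orderedProd u i * (u i - 1)

@[simp] lemma orderedProd_zero (u : ℕ → R) : orderedProd u 0 = 1 := rfl

lemma orderedProd_succ (u : ℕ → R) (n : ℕ) :
    orderedProd u (n + 1) = orderedProd u n * u n := rfl

lemma orderedProd_add (u : ℕ → R) (n m : ℕ) :
    orderedProd u (n + m) = orderedProd u n * orderedProd (fun k => u (n + k)) m := by
  induction m with
  | zero => simp
  | succ m ih => rw [← add_assoc, orderedProd_succ, ih, orderedProd_succ, mul_assoc]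

lemma orderedProd_congr {u v : ℕ → R} {n : ℕ} (h : ∀ i < n, u i = v i) :
    orderedProd u n = orderedProd v n := by
  induction n with
  | zero => rfl
  | succ n ih =>
    rw [orderedProd_succ, orderedProd_succ, ih fun i hi => h i (hi.trans n.lt_succ_self),
      h n n.lt_succ_self]

lemma orderedProd_eq_one {u : ℕ → R} {n : ℕ} (h : ∀ i < n, u i = 1) : orderedProd u n = 1 := by
  induction n with
  | zero => rfl
  | succ n ih =>
    rw [orderedProd_succ, ih fun i hi => h i (hi.trans n.lt_succ_self), h n n.lt_succ_self, one_mul]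

lemma isUnit_orderedProd {u : ℕ → R} {n : ℕ} (h : ∀ i < n, IsUnit (u i)) :
    IsUnit (orderedProd u n) := by
  induction n with
  | zero => exact isUnit_one
  | succ n ih =>
    exact (ih fun i hi => h i (hi.trans n.lt_succ_self)).mul (h n n.lt_succ_self)

lemma orderedProd_eq_sum (u : ℕ → R) (n : ℕ) :
    orderedProd u n = 1 + ∑ i ∈ Finset.range n, orderedProd u i * (u i - 1) := by
  induction n with
  | zero => simp
  | succ n ih =>
    rw [Finset.sum_range_succ, ← add_assoc, ← ih, orderedProd_succ]
    noncomm_ring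

lemma norm_orderedProd_le {u : ℕ → R} {c : ℕ → ℝ} {n : ℕ} (h : ∀ i < n, ‖u i - 1‖ ≤ c i) :
    ‖orderedProd u n‖ ≤ ‖(1 : R)‖ * Real.exp (∑ i ∈ Finset.range n, c i) := by
  induction n with
  | zero => simp
  | succ n ih =>
    have ih' := ih fun i hi => h i (hi.trans n.lt_succ_self)
    have hn := h n n.lt_succ_self
    have e : orderedProd u (n + 1) = orderedProd u n + orderedProd u n * (u n - 1) := by
      rw [orderedProd_succ]; noncomm_ring
    calc ‖orderedProd u (n + 1)‖ ≤ ‖orderedProd u n‖ + ‖orderedProd u n‖ * ‖u n - 1‖ := by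
          rw [e]; exact (norm_add_le _ _).trans (by gcongr; exact norm_mul_le _ _)
      _ ≤ ‖orderedProd u n‖ * (1 + c n) := by
          rw [mul_add, mul_one]; gcongr
      _ ≤ ‖orderedProd u n‖ * Real.exp (c n) := by
          gcongr; rw [add_comm]; exact Real.add_one_le_exp _
      _ ≤ ‖(1 : R)‖ * Real.exp (∑ i ∈ Finset.range n, c i) * Real.exp (c n) := by gcongr
      _ = _ := by rw [Finset.sum_range_succ, Real.exp_add, mul_assoc]

lemma norm_orderedProd_sub_one_le {u : ℕ → R} {c : ℕ → ℝ} {n : ℕ} {C : ℝ}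
    (h : ∀ i < n, ‖u i - 1‖ ≤ c i) (hC : ∑ i ∈ Finset.range n, c i ≤ C) :
    ‖orderedProd u n - 1‖ ≤ ‖(1 : R)‖ * Real.exp C * C := by
  rw [orderedProd_eq_sum, add_sub_cancel_left]
  calc _ ≤ ∑ i ∈ Finset.range n, ‖(1 : R)‖ * Real.exp C * c i := by
        refine norm_sum_le_of_le _ fun i hi => ?_
        have hi' := Finset.mem_range.1 hi
        have hs : ∑ j ∈ Finset.range i, c j ≤ C := le_trans
          (Finset.sum_le_sum_of_subset_of_nonneg
            (Finset.range_subset_range.2 hi'.le)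
            fun j hj _ => (norm_nonneg _).trans (h j (Finset.mem_range.1 hj))) hC
        refine (norm_mul_le _ _).trans ?_
        have := norm_orderedProd_le (fun j hj => h j (hj.trans hi'))
        have h2 := h i hi'
        have h3 := Real.exp_le_exp.2 hs
        gcongr
        exact this.trans (by gcongr)
    _ ≤ _ := by
        rw [← Finset.mul_sum]; gcongr

variable {c : ℕ → ℝ}

lemma norm_orderedProd_mul_le (hc : Summable c) {u : ℕ → R} (h : ∀ i, ‖u i - 1‖ ≤ c i) (i : ℕ) :
    ‖orderedProd u i * (u i - 1)‖ ≤ ‖(1 : R)‖ * Real.exp (∑' j, c j) * c i := by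
  have h0 : ∀ j, 0 ≤ c j := fun j => (norm_nonneg _).trans (h j)
  have h1 := hc.sum_le_tsum (Finset.range i) fun j _ => h0 j
  have h2 := norm_orderedProd_le (n := i) fun j _ => h j
  have h3 := h i
  have h4 := Real.exp_le_exp.2 h1
  refine (norm_mul_le _ _).trans ?_
  gcongr
  exact h2.trans (by gcongr)

lemma differentiableOn_orderedProd [NormedAlgebra ℂ R] {U : Set ℂ} {u : ℕ → ℂ → R} {n : ℕ}
    (h : ∀ i < n, DifferentiableOn ℂ (u i) U) :
    DifferentiableOn ℂ (fun z => orderedProd (fun i => u i z) n) U := by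
  induction n with
  | zero => exact differentiableOn_const _
  | succ n ih =>
    exact (ih fun i hi => h i (hi.trans n.lt_succ_self)).mul (h n n.lt_succ_self)

lemma differentiable_orderedProd [NormedAlgebra ℂ R] {u : ℕ → ℂ → R} {n : ℕ}
    (h : ∀ i < n, Differentiable ℂ (u i)) :
    Differentiable ℂ (fun z => orderedProd (fun i => u i z) n) :=
  differentiableOn_univ.1 (differentiableOn_orderedProd fun i hi => (h i hi).differentiableOn)

/-- Pointwise limits that are holomorphic and invertible on every disc glue to an entire function
with invertible values. -/
lemma exists_entire_limit [NormedAlgebra ℂ R] {z₀ : ℂ} {G : ℕ → ℂ → R}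
    (h : ∀ r : ℝ, ∃ H : ℂ → R, DifferentiableOn ℂ H (Metric.ball z₀ r) ∧
      ∀ z ∈ Metric.ball z₀ r, IsUnit (H z) ∧ Tendsto (fun n => G n z) atTop (𝓝 (H z))) :
    ∃ H : ℂ → R, Differentiable ℂ H ∧ ∀ z, IsUnit (H z) ∧
      Tendsto (fun n => G n z) atTop (𝓝 (H z)) := by
  choose H hd hH using h
  have hmem : ∀ z : ℂ, z ∈ Metric.ball z₀ (dist z z₀ + 1) := fun z => by
    simp [Metric.mem_ball]
  refine ⟨fun z => H (dist z z₀ + 1) z, fun z => ?_, fun z => hH _ z (hmem z)⟩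
  have hz := Metric.isOpen_ball.mem_nhds (hmem z)
  refine ((hd _).differentiableAt hz).congr_of_eventuallyEq ?_
  filter_upwards [hz] with x hx
  exact tendsto_nhds_unique (hH _ x (hmem x)).2 (hH _ x hx).2

variable [CompleteSpace R]

lemma tendstoUniformlyOn_orderedProd {α : Type*} {S : Set α} (hc : Summable c) {u : ℕ → α → R}
    (h : ∀ i, ∀ z ∈ S, ‖u i z - 1‖ ≤ c i) :
    TendstoUniformlyOn (fun n z => orderedProd (fun i => u i z) n)
      (fun z => infiniteProd fun i => u i z) atTop S := by
  have := tendstoUniformlyOn_tsum_nat (s := S)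
    (f := fun i z => orderedProd (fun j => u j z) i * (u i z - 1))
    (hc.mul_left (‖(1 : R)‖ * Real.exp (∑' j, c j)))
    fun i z hz => norm_orderedProd_mul_le hc (fun j => h j z hz) i
  have e : (fun n z => orderedProd (fun i => u i z) n) = fun n z =>
      1 + ∑ i ∈ Finset.range n, orderedProd (fun j => u j z) i * (u i z - 1) :=
    funext fun n => funext fun z => orderedProd_eq_sum _ n
  rw [e]
  have h1 : TendstoUniformlyOn (fun (_ : ℕ) (_ : α) => (1 : R)) (fun _ => 1) atTop S :=
    fun v hv => Eventually.of_forall fun _ _ _ => refl_mem_uniformity hv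
  exact h1.add this

lemma tendsto_orderedProd (hc : Summable c) {u : ℕ → R} (h : ∀ i, ‖u i - 1‖ ≤ c i) :
    Tendsto (orderedProd u) atTop (𝓝 (infiniteProd u)) :=
  (tendstoUniformlyOn_orderedProd (S := Set.univ) (u := fun i (_ : Unit) => u i) hc
    fun i _ _ => h i).tendsto_at (Set.mem_univ ())

lemma infiniteProd_eq_mul (hc : Summable c) {u : ℕ → R} (h : ∀ i, ‖u i - 1‖ ≤ c i) (n : ℕ) :
    infiniteProd u = orderedProd u n * infiniteProd fun k => u (n + k) := by
  have h1 := (tendsto_add_atTop_iff_nat n).2 (tendsto_orderedProd hc h)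
  have hc' : Summable fun k => c (n + k) := by
    simpa only [add_comm] using (summable_nat_add_iff n).2 hc
  have h2 := (tendsto_orderedProd hc' fun i => h (n + i)).const_mul (orderedProd u n)
  refine tendsto_nhds_unique h1 (h2.congr fun m => ?_)
  rw [← orderedProd_add, add_comm]

lemma isUnit_of_norm_sub_one_lt_one {x : R} (h : ‖x - 1‖ < 1) : IsUnit x := by
  have : ‖1 - x‖ < 1 := by rwa [norm_sub_rev]
  simpa using (Units.oneSub (1 - x) this).isUnit

lemma norm_inverse_sub_one_le {x : R} {η : ℝ} (hη : η ≤ 1 / 2) (h : ‖x - 1‖ ≤ η) :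
    ‖Ring.inverse x - 1‖ ≤ 2 * η := by
  have hu : IsUnit x := isUnit_of_norm_sub_one_lt_one (by linarith)
  set y := Ring.inverse x - 1 with hy
  have e : y = -(x - 1) - y * (x - 1) := by
    have := Ring.inverse_mul_cancel x hu
    rw [hy, sub_mul, mul_sub, this]; noncomm_ring
  have h1 : ‖y‖ ≤ ‖x - 1‖ + ‖y‖ * ‖x - 1‖ := by
    nth_rw 1 [e]
    refine (norm_sub_le _ _).trans ?_
    rw [norm_neg]; gcongr; exact norm_mul_le _ _
  nlinarith [norm_nonneg y, norm_nonneg (x - 1)]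

/-- An infinite product of invertible elements is invertible: a tail of it is close to `1`. -/
lemma isUnit_infiniteProd (hc : Summable c) {u : ℕ → R} (h : ∀ i, ‖u i - 1‖ ≤ c i)
    (hu : ∀ i, IsUnit (u i)) : IsUnit (infiniteProd u) := by
  have h0 : ∀ j, 0 ≤ c j := fun j => (norm_nonneg _).trans (h j)
  have ht : Tendsto (fun n => ‖(1 : R)‖ * Real.exp (∑' k, c (k + n)) * ∑' k, c (k + n))
      atTop (𝓝 0) := by
    have h1 := tendsto_sum_nat_add c
    have := (((Real.continuous_exp.tendsto 0).comp h1).const_mul ‖(1 : R)‖).mul h1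
    simpa using this
  obtain ⟨n, hn⟩ := (ht.eventually_lt_const (one_pos)).exists
  rw [infiniteProd_eq_mul hc h n]
  refine (isUnit_orderedProd fun i _ => hu i).mul (isUnit_of_norm_sub_one_lt_one ?_)
  have hc' : Summable fun k => c (k + n) := (summable_nat_add_iff n).2 hc
  have h2 : Tendsto (orderedProd fun k => u (n + k)) atTop (𝓝 (infiniteProd fun k => u (n + k))) :=
    tendsto_orderedProd hc' fun i => by rw [add_comm n]; exact h _
  refine lt_of_le_of_lt (le_of_tendsto (h2.sub_const 1).norm
    (Eventually.of_forall fun m => ?_)) hn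
  refine norm_orderedProd_sub_one_le (c := fun k => c (k + n))
    (fun i _ => by rw [add_comm n]; exact h _) ?_
  exact hc'.sum_le_tsum _ fun j _ => h0 _

/-- Dominated convergence for infinite products whose factors vary with a parameter `N`. -/
lemma tendsto_orderedProd_of_dominated (hc : Summable c) {u : ℕ → ℕ → R} {v : ℕ → R} {m : ℕ → ℕ}
    (h : ∀ N i, ‖u N i - 1‖ ≤ c i) (hv : ∀ i, Tendsto (fun N => u N i) atTop (𝓝 (v i)))
    (hm : Tendsto m atTop atTop) :
    Tendsto (fun N => orderedProd (u N) (m N)) atTop (𝓝 (infiniteProd v)) := by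
  have hp : ∀ i, Tendsto (fun N => orderedProd (u N) i) atTop (𝓝 (orderedProd v i)) := by
    intro i
    induction i with
    | zero => exact tendsto_const_nhds
    | succ i ih => exact ih.mul (hv i)
  have key : Tendsto (fun N => ∑' i, if i < m N then orderedProd (u N) i * (u N i - 1) else 0)
      atTop (𝓝 (∑' i, orderedProd v i * (v i - 1))) := by
    refine tendsto_tsum_of_dominated_convergence
      (hc.mul_left (‖(1 : R)‖ * Real.exp (∑' j, c j))) (fun i => ?_)
      (Eventually.of_forall fun N i => ?_)
    · refine ((hp i).mul ((hv i).sub_const 1)).congr' ?_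
      filter_upwards [hm.eventually_gt_atTop i] with N hN
      rw [if_pos hN]
    · split_ifs
      · exact norm_orderedProd_mul_le hc (h N) i
      · rw [norm_zero]
        exact (norm_nonneg _).trans (norm_orderedProd_mul_le hc (h N) i)
  refine (key.const_add 1).congr fun N => ?_
  rw [orderedProd_eq_sum, tsum_eq_sum (s := Finset.range (m N))]
  · congr 1
    exact Finset.sum_congr rfl fun i hi => if_pos (Finset.mem_range.1 hi)
  · intro i hi
    exact if_neg fun hlt => hi (Finset.mem_range.2 hlt)

lemma differentiableOn_infiniteProd [NormedAlgebra ℂ R] {U : Set ℂ} (hU : IsOpen U)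
    (hc : Summable c) {u : ℕ → ℂ → R}
    (h : ∀ i, ∀ z ∈ U, ‖u i z - 1‖ ≤ c i) (hu : ∀ i, DifferentiableOn ℂ (u i) U) :
    DifferentiableOn ℂ (fun z => infiniteProd fun i => u i z) U :=
  (tendstoUniformlyOn_orderedProd hc h).tendstoLocallyUniformlyOn.differentiableOn
    (Eventually.of_forall fun _ => differentiableOn_orderedProd fun i _ => hu i) hU

end OrderedProduct

/-! ### Elementary factors -/

/-- The exponent `w + w ^ 2 / 2 + ⋯ + w ^ n / n` of the scalar Weierstrass factor of degree `n`. -/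
def scalarExponent (n : ℕ) (w : ℂ) : ℂ := ∑ k ∈ Finset.Icc 1 n, w ^ k / (k : ℂ)

/-- The scalar Weierstrass factor `(1 - w) exp (w + w ^ 2 / 2 + ⋯ + w ^ n / n)`. -/
def scalarFactor (n : ℕ) (w : ℂ) : ℂ := (1 - w) * Complex.exp (scalarExponent n w)

lemma scalarFactor_eq_exp {n : ℕ} {w : ℂ} (hw : ‖w‖ < 1) :
    scalarFactor n w = Complex.exp (Complex.log (1 + -w) - Complex.logTaylor (n + 1) (-w)) := by
  have h1 : (1 : ℂ) - w ≠ 0 := by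
    intro h
    rw [← sub_eq_zero.1 h] at hw
    simp at hw
  have h2 : scalarExponent n w = -Complex.logTaylor (n + 1) (-w) := by
    unfold scalarExponent Complex.logTaylor
    rw [Finset.range_eq_Ico, Finset.sum_eq_sum_Ico_succ_bot (Nat.succ_pos n)]
    simp only [pow_zero, Nat.cast_zero, div_zero, zero_add]
    rw [← Finset.sum_neg_distrib]
    refine Finset.sum_congr (by ext; simp) fun k _ => ?_
    rw [neg_pow w k, pow_succ]
    have : ((-1 : ℂ) ^ k) * (-1) ^ k = 1 := by rw [← mul_pow]; simp
    linear_combination (-(w ^ k) / k) * this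
  rw [sub_eq_add_neg, Complex.exp_add, ← h2, ← sub_eq_add_neg, Complex.exp_log h1, scalarFactor]

/-- On a disc of radius less than `1` the scalar factors tend to `1` geometrically in the degree,
because the exponent is a Taylor polynomial of `-log (1 - w)`. -/
lemma exists_norm_scalarFactor_sub_one_le {q : ℝ} (hq : q < 1) :
    ∃ C : ℝ, 0 ≤ C ∧ ∀ (n : ℕ) (w : ℂ), ‖w‖ ≤ q → ‖scalarFactor n w - 1‖ ≤ C * q ^ n := by
  have h1 : 0 < 1 - q := by linarith
  refine ⟨(1 - q)⁻¹ * Real.exp (1 - q)⁻¹, by positivity, fun n w hw => ?_⟩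
  have hq0 : 0 ≤ q := (norm_nonneg w).trans hw
  set x := Complex.log (1 + -w) - Complex.logTaylor (n + 1) (-w)
  have hx : ‖x‖ ≤ q ^ n * (1 - q)⁻¹ := by
    have h2 := Complex.norm_log_sub_logTaylor_le n (z := -w) (by rw [norm_neg]; linarith)
    rw [norm_neg] at h2
    have h3 : 0 < 1 - ‖w‖ := by linarith
    calc _ ≤ _ := h2
      _ ≤ ‖w‖ ^ (n + 1) * (1 - ‖w‖)⁻¹ := div_le_self (by positivity) (by simp)
      _ ≤ q ^ (n + 1) * (1 - q)⁻¹ := by gcongr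
      _ ≤ q ^ n * (1 - q)⁻¹ := by
        gcongr ?_ * _
        exact pow_le_pow_of_le_one hq0 hq.le n.le_succ
  have hx' : ‖x‖ ≤ (1 - q)⁻¹ := hx.trans
    (mul_le_of_le_one_left (by positivity) (pow_le_one₀ hq0 hq.le))
  rw [scalarFactor_eq_exp (by linarith)]
  have h4 := Complex.norm_exp_sub_sum_le_norm_mul_exp x 1
  simp only [Finset.range_one, Finset.sum_singleton, pow_zero, Nat.factorial_zero, Nat.cast_one,
    div_one, pow_one] at h4
  calc _ ≤ _ := h4
    _ ≤ (q ^ n * (1 - q)⁻¹) * Real.exp (1 - q)⁻¹ := by gcongr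
    _ = _ := by ring

section Scaling

variable {R : Type*} [Ring R] [Algebra ℂ R] {P : R}

/-- For an idempotent `P`, the element acting as the scalar `x` on the range of `P` and as the
identity on its kernel. -/
def scaleOn (P : R) (x : ℂ) : R := (1 - P) + x • P

lemma scaleOn_mul (hP : IsIdempotentElem P) (x y : ℂ) :
    scaleOn P x * scaleOn P y = scaleOn P (x * y) := by
  have h : P * P = P := hP
  simp only [scaleOn, mul_add, add_mul, sub_mul, mul_sub, smul_mul_assoc, mul_smul_comm, h,
    one_mul, mul_one]
  simp only [sub_self, zero_add]
  rw [smul_smul, mul_comm y x]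
  abel

lemma scaleOn_one : scaleOn P 1 = 1 := by simp [scaleOn]

lemma scaleOn_mul_inv (hP : IsIdempotentElem P) {x : ℂ} (hx : x ≠ 0) :
    scaleOn P x * scaleOn P x⁻¹ = 1 := by
  rw [scaleOn_mul hP, mul_inv_cancel₀ hx, scaleOn_one]

lemma scaleOn_inv_mul (hP : IsIdempotentElem P) {x : ℂ} (hx : x ≠ 0) :
    scaleOn P x⁻¹ * scaleOn P x = 1 := by
  rw [scaleOn_mul hP, inv_mul_cancel₀ hx, scaleOn_one]

lemma isUnit_scaleOn (hP : IsIdempotentElem P) {x : ℂ} (hx : x ≠ 0) : IsUnit (scaleOn P x) :=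
  ⟨⟨_, _, scaleOn_mul_inv hP hx, scaleOn_inv_mul hP hx⟩, rfl⟩

end Scaling

/-- The nonvanishing part of the scalar factor with zero `a`: one has
`scalarFactor n ((z - z₀) / (a - z₀)) = (a - z) * scalarCofactor z₀ a n z`. -/
def scalarCofactor (z₀ a : ℂ) (n : ℕ) (z : ℂ) : ℂ :=
  Complex.exp (scalarExponent n ((z - z₀) / (a - z₀))) / (a - z₀)

lemma scalarFactor_eq_mul_cofactor {z₀ a : ℂ} (ha : a ≠ z₀) (n : ℕ) (z : ℂ) :
    scalarFactor n ((z - z₀) / (a - z₀)) = (a - z) * scalarCofactor z₀ a n z := by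
  have : a - z₀ ≠ 0 := sub_ne_zero.2 ha
  rw [scalarFactor, scalarCofactor, one_sub_div this]
  field_simp
  ring

lemma scalarCofactor_ne_zero {z₀ a : ℂ} (ha : a ≠ z₀) (n : ℕ) (z : ℂ) :
    scalarCofactor z₀ a n z ≠ 0 :=
  div_ne_zero (Complex.exp_ne_zero _) (sub_ne_zero.2 ha)

lemma scalarFactor_ne_zero {z₀ a z : ℂ} (ha : a ≠ z₀) (n : ℕ) (hz : z ≠ a) :
    scalarFactor n ((z - z₀) / (a - z₀)) ≠ 0 := by
  rw [scalarFactor_eq_mul_cofactor ha]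
  exact mul_ne_zero (sub_ne_zero.2 hz.symm) (scalarCofactor_ne_zero ha n z)

lemma scalarFactor_self {z₀ a : ℂ} (ha : a ≠ z₀) (n : ℕ) :
    scalarFactor n ((a - z₀) / (a - z₀)) = 0 := by
  rw [scalarFactor_eq_mul_cofactor ha, sub_self, zero_mul]

lemma differentiable_scalarCofactor (z₀ a : ℂ) (n : ℕ) :
    Differentiable ℂ (scalarCofactor z₀ a n) := by
  unfold scalarCofactor scalarExponent
  fun_prop

lemma differentiable_scalarFactor (z₀ a : ℂ) (n : ℕ) :
    Differentiable ℂ fun z => scalarFactor n ((z - z₀) / (a - z₀)) := by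
  unfold scalarFactor scalarExponent
  fun_prop

section Operator

variable {X : Type*} [NormedAddCommGroup X] [InnerProductSpace ℂ X]

lemma partialProduct_eq_orderedProd (z₀ : ℂ) (a : ℕ → ℂ) (P : ℕ → X →L[ℂ] X) (n : ℕ) (z : ℂ) :
    partialProduct z₀ a P n z =
      orderedProd (fun i => elementaryFactor (P i) (i + 1) ((z - z₀) / (a i - z₀))) n := by
  induction n with
  | zero => rfl
  | succ n ih => rw [partialProduct, ih, orderedProd_succ]

variable [CompleteSpace X] {P : X →L[ℂ] X}

lemma exp_smul_of_isIdempotentElem (hP : IsIdempotentElem P) (s : ℂ) :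
    NormedSpace.exp (s • P) = scaleOn P (Complex.exp s) := by
  have h1 := (NormedSpace.exp_series_hasSum_exp' (𝕂 := ℂ) s).smul_const P
  have h2 := h1.add (hasSum_ite_eq 0 (1 - P))
  rw [← Complex.exp_eq_exp_ℂ, add_comm] at h2
  refine HasSum.unique (NormedSpace.exp_series_hasSum_exp' (𝕂 := ℂ) (s • P)) ?_
  have e : (fun n : ℕ => ((n.factorial : ℂ)⁻¹ • (s • P) ^ n)) = fun n : ℕ =>
      ((n.factorial : ℂ)⁻¹ • s ^ n) • P + if n = 0 then 1 - P else 0 := by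
    funext n
    rcases eq_or_ne n 0 with rfl | hn
    · simp
    · rw [if_neg hn, add_zero, smul_pow, hP.pow_eq hn, smul_eq_mul, smul_smul]
  rw [e]
  exact h2

lemma elementaryFactor_eq (hP : IsIdempotentElem P) (n : ℕ) (w : ℂ) :
    elementaryFactor P n w = scaleOn P (scalarFactor n w) := by
  have h : (1 : X →L[ℂ] X) - w • P = scaleOn P (1 - w) := by
    rw [scaleOn, sub_smul, one_smul]; abel
  rw [elementaryFactor, ← Finset.sum_smul, exp_smul_of_isIdempotentElem hP, h, scaleOn_mul hP]
  rfl

lemma norm_elementaryFactor_sub_one_le (hP : IsStarProjection P) (n : ℕ) (w : ℂ) :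
    ‖elementaryFactor P n w - 1‖ ≤ ‖scalarFactor n w - 1‖ := by
  have : elementaryFactor P n w - 1 = (scalarFactor n w - 1) • P := by
    rw [elementaryFactor_eq hP.isIdempotentElem, scaleOn, sub_smul, one_smul]; abel
  rw [this, norm_smul]
  exact mul_le_of_le_one_right (norm_nonneg _) (IsStarProjection.norm_le P hP)

lemma elementaryFactor_zero (n : ℕ) (w : ℂ) : elementaryFactor (0 : X →L[ℂ] X) n w = 1 := by
  rw [elementaryFactor_eq IsIdempotentElem.zero]; simp [scaleOn]

lemma isUnit_elementaryFactor (hP : IsIdempotentElem P) {z₀ a z : ℂ} (ha : a ≠ z₀) (n : ℕ)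
    (hz : z ≠ a) : IsUnit (elementaryFactor P n ((z - z₀) / (a - z₀))) := by
  rw [elementaryFactor_eq hP]
  exact isUnit_scaleOn hP (scalarFactor_ne_zero ha n hz)

lemma differentiable_elementaryFactor (hP : IsIdempotentElem P) (z₀ a : ℂ) (n : ℕ) :
    Differentiable ℂ fun z => elementaryFactor P n ((z - z₀) / (a - z₀)) := by
  simp_rw [elementaryFactor_eq hP, scaleOn]
  exact ((differentiable_scalarFactor z₀ a n).smul_const P).const_add _

lemma tendsto_elementaryFactor {p : ℕ → X →L[ℂ] X} (hp : ∀ N, IsIdempotentElem (p N))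
    (hP : IsIdempotentElem P) (h : Tendsto p atTop (𝓝 P)) (n : ℕ) (w : ℂ) :
    Tendsto (fun N => elementaryFactor (p N) n w) atTop (𝓝 (elementaryFactor P n w)) := by
  simp_rw [fun N => elementaryFactor_eq (hp N) n w, elementaryFactor_eq hP, scaleOn]
  exact (h.const_sub 1).add (h.const_smul _)

end Operator

/-! ### Poles of the inverse of a holomorphic function -/

section InverseOrder

variable {R : Type*} [NormedRing R] [NormedAlgebra ℂ R] {A : ℂ → R} {b : ℂ} {p : ℕ}

/-- Near `b`, but not necessarily at `b`, the values of `A` are invertible, and `A⁻¹` has at `b`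
a pole of order at most `p` (or no singularity). The function `B` is `(z - b) ^ p • (A z)⁻¹`. -/
def HasInverseOrder (A : ℂ → R) (b : ℂ) (p : ℕ) : Prop :=
  ∃ B : ℂ → R, AnalyticAt ℂ B b ∧ ∀ᶠ z in 𝓝[≠] b,
    A z * B z = (z - b) ^ p • (1 : R) ∧ B z * A z = (z - b) ^ p • (1 : R)

lemma HasInverseOrder.eventually_isUnit (h : HasInverseOrder A b p) :
    ∀ᶠ z in 𝓝[≠] b, IsUnit (A z) := by
  obtain ⟨B, -, hB⟩ := h
  filter_upwards [hB, self_mem_nhdsWithin] with z ⟨h1, h2⟩ hz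
  have hz' : (z - b) ^ p ≠ 0 := pow_ne_zero _ (sub_ne_zero.2 hz)
  refine ⟨⟨A z, ((z - b) ^ p)⁻¹ • B z, ?_, ?_⟩, rfl⟩
  · rw [mul_smul_comm, h1, smul_smul, inv_mul_cancel₀ hz', one_smul]
  · rw [smul_mul_assoc, h2, smul_smul, inv_mul_cancel₀ hz', one_smul]

/-- By continuity, the relations between `A` and `B` persist at the point itself. -/
lemma HasInverseOrder.exists_mul_eq (h : HasInverseOrder A b p) (hA : ContinuousAt A b) :
    ∃ B : ℂ → R, AnalyticAt ℂ B b ∧ (∀ᶠ z in 𝓝[≠] b,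
      A z * B z = (z - b) ^ p • (1 : R) ∧ B z * A z = (z - b) ^ p • (1 : R)) ∧
      A b * B b = (0 : ℂ) ^ p • (1 : R) ∧ B b * A b = (0 : ℂ) ^ p • (1 : R) := by
  obtain ⟨B, hBa, hB⟩ := h
  have hc : ContinuousAt (fun z : ℂ => (z - b) ^ p • (1 : R)) b := by fun_prop
  refine ⟨B, hBa, hB, ?_, ?_⟩
  · have := tendsto_nhds_unique_of_eventuallyEq
      ((hA.mul hBa.continuousAt).tendsto.mono_left nhdsWithin_le_nhds)
      (hc.tendsto.mono_left nhdsWithin_le_nhds) (hB.mono fun z hz => hz.1)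
    simpa using this
  · have := tendsto_nhds_unique_of_eventuallyEq
      ((hBa.continuousAt.mul hA).tendsto.mono_left nhdsWithin_le_nhds)
      (hc.tendsto.mono_left nhdsWithin_le_nhds) (hB.mono fun z hz => hz.2)
    simpa using this

lemma HasInverseOrder.isUnit (h : HasInverseOrder A b 0) (hA : ContinuousAt A b) :
    IsUnit (A b) := by
  obtain ⟨B, -, -, h1, h2⟩ := h.exists_mul_eq hA
  exact ⟨⟨A b, B b, by simpa using h1, by simpa using h2⟩, rfl⟩

lemma eventually_isUnit_of_isUnit {R : Type*} [NormedRing R] [CompleteSpace R] {A : ℂ → R} {b : ℂ}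
    (hA : ContinuousAt A b) (h : IsUnit (A b)) :
    ∀ᶠ z in 𝓝 b, IsUnit (A z) :=
  hA.eventually (Units.isOpen.mem_nhds h)

lemma analyticAt_inverse_comp [CompleteSpace R] (hA : AnalyticAt ℂ A b) (h : IsUnit (A b)) :
    AnalyticAt ℂ (fun z => Ring.inverse (A z)) b := by
  obtain ⟨u, hu⟩ := h
  have h1 : AnalyticAt ℂ (Ring.inverse : R → R) (A b) := hu ▸ analyticAt_inverse (𝕜 := ℂ) u
  exact h1.comp hA

lemma HasInverseOrder.of_isUnit [CompleteSpace R] (hA : AnalyticAt ℂ A b) (h : IsUnit (A b)) :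
    HasInverseOrder A b 0 := by
  refine ⟨fun z => Ring.inverse (A z), analyticAt_inverse_comp hA h, ?_⟩
  filter_upwards [(eventually_isUnit_of_isUnit hA.continuousAt h).filter_mono
    nhdsWithin_le_nhds] with z hz
  simp [Ring.mul_inverse_cancel _ hz, Ring.inverse_mul_cancel _ hz]

end InverseOrder

/-! ### Holomorphic families of Fredholm operators -/

section Fredholm

variable {X : Type*} [NormedAddCommGroup X] [InnerProductSpace ℂ X]

lemma isFredholm_of_sub_hasNoetherianRange [CompleteSpace X] {u v : X →L[ℂ] X} (hu : u.IsFredholm)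
    (h : ((v - u : X →L[ℂ] X) : X →ₗ[ℂ] X).HasNoetherianRange) : v.IsFredholm := by
  open scoped LinearMap.FiniteRangeSetoid in
  obtain ⟨w, hw⟩ := hu.exists_isQuasiInverse
  have hvu : (v : X →ₗ[ℂ] X) ≈ u := by
    rw [LinearMap.FiniteRangeSetoid.equiv_iff_hasNoetherianRange]
    exact h
  exact .of_isQuasiInverse (hw.congr (Setoid.refl _) hvu)

/-- A Fredholm operator that is a limit of invertible operators is the sum of an invertible
operator and an operator of finite rank. -/
lemma exists_isUnit_add_finiteRank [CompleteSpace X] {u : X →L[ℂ] X} (hu : u.IsFredholm)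
    (hcl : u ∈ closure {U : X →L[ℂ] X | IsUnit U}) :
    ∃ H k : X →L[ℂ] X, IsUnit H ∧ (k : X →ₗ[ℂ] X).HasNoetherianRange ∧ u = H + k := by
  obtain ⟨v, -, hv⟩ := hu.exists_isQuasiInverse
  set k₁ : X →L[ℂ] X := u * v - 1
  have hk₁ : (k₁ : X →ₗ[ℂ] X).HasNoetherianRange := by
    have := LinearMap.FiniteRangeSetoid.equiv_iff_hasNoetherianRange.1 hv.equiv
    exact this
  -- `U * v - k₁` is close to `u * v - k₁ = 1` when `U` is close to `u`.
  have hcont : Tendsto (fun U : X →L[ℂ] X => U * v - k₁) (𝓝 u) (𝓝 1) := by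
    have : Continuous fun U : X →L[ℂ] X => U * v - k₁ := by fun_prop
    have h := this.tendsto u
    simpa [k₁] using h
  have hev := hcont.eventually (Units.isOpen.mem_nhds (isUnit_one (M := X →L[ℂ] X)))
  obtain ⟨U, hU, hM⟩ := (mem_closure_iff_frequently.1 hcl).and_eventually hev |>.exists
  obtain ⟨U, rfl⟩ := hU
  obtain ⟨M, hM⟩ := hM
  have hv' : v = ↑U⁻¹ * (↑M + k₁) := by
    rw [hM, sub_add_cancel, Units.inv_mul_cancel_left]
  have huv : u * v = 1 + k₁ := by simp [k₁]
  have hu' : u * ↑U⁻¹ * ↑M = 1 + (k₁ - u * ↑U⁻¹ * k₁) := by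
    rw [hv'] at huv
    rw [← add_sub_assoc, ← huv]; noncomm_ring
  refine ⟨↑(M⁻¹ * U), (k₁ - u * ↑U⁻¹ * k₁) * ↑(M⁻¹ * U), Units.isUnit _, ?_, ?_⟩
  · exact (hk₁.sub (hk₁.comp_left (u * ↑U⁻¹ : X →L[ℂ] X).toLinearMap)).comp_right
      ((M⁻¹ * U : (X →L[ℂ] X)ˣ) : X →L[ℂ] X).toLinearMap
  · have : u = u * ↑U⁻¹ * ↑M * ↑(M⁻¹ * U) := by simp [mul_assoc]
    rw [hu', add_mul, one_mul] at this
    exact this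

lemma exists_factorization_of_finiteRank {k : X →L[ℂ] X}
    (hk : (k : X →ₗ[ℂ] X).HasNoetherianRange) :
    ∃ (n : ℕ) (κ : X →L[ℂ] (Fin n → ℂ)) (ι : (Fin n → ℂ) →L[ℂ] X), ∀ x, k x = ι (κ x) := by
  have : IsNoetherian ℂ (k : X →ₗ[ℂ] X).range := hk
  let e := (Module.finBasis ℂ (k : X →ₗ[ℂ] X).range).equivFunL
  refine ⟨_, e.toContinuousLinearMap ∘L k.codRestrict (k : X →ₗ[ℂ] X).range fun x => ⟨x, rfl⟩,
    ((k : X →ₗ[ℂ] X).range.subtypeL) ∘L e.symm.toContinuousLinearMap, fun x => ?_⟩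
  exact (congrArg Subtype.val (e.symm_apply_apply ⟨k x, x, rfl⟩)).symm

lemma differentiableAt_det {n : ℕ} {M : ℂ → Matrix (Fin n) (Fin n) ℂ} {x : ℂ}
    (h : ∀ i j, DifferentiableAt ℂ (fun z => M z i j) x) :
    DifferentiableAt ℂ (fun z => (M z).det) x := by
  simp_rw [Matrix.det_apply']
  refine DifferentiableAt.fun_sum fun σ _ => DifferentiableAt.const_mul ?_ _
  exact DifferentiableAt.fun_finsetProd fun i _ => h _ _

lemma differentiableAt_adjugate {n : ℕ} {M : ℂ → Matrix (Fin n) (Fin n) ℂ} {x : ℂ}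
    (h : ∀ i j, DifferentiableAt ℂ (fun z => M z i j) x) (i j : Fin n) :
    DifferentiableAt ℂ (fun z => (M z).adjugate i j) x := by
  simp_rw [Matrix.adjugate_apply]
  refine differentiableAt_det fun k l => ?_
  simp_rw [Matrix.updateRow_apply]
  split_ifs
  · exact differentiableAt_const _
  · exact h k l

section Determinant

variable {n : ℕ} (κ : X →L[ℂ] (Fin n → ℂ)) (ι : (Fin n → ℂ) →L[ℂ] X)

/-- The matrix of `1 + κ G ι`, which carries the invertibility of `1 + G ι κ`. -/
def sylvesterMatrix (G : X →L[ℂ] X) : Matrix (Fin n) (Fin n) ℂ :=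
  1 + LinearMap.toMatrix' (κ ∘L G ∘L ι : (Fin n → ℂ) →L[ℂ] (Fin n → ℂ)).toLinearMap

/-- The operator `det m • 1 - G ι (adj m) κ`, where `m` is the matrix of `1 + κ G ι`. It plays the
role of the adjugate of `1 + G ι κ`. -/
def sylvesterAdjugate (G : X →L[ℂ] X) : X →L[ℂ] X :=
  (sylvesterMatrix κ ι G).det • 1 - ∑ i, ∑ j, (sylvesterMatrix κ ι G).adjugate i j •
    (G ∘L ι ∘L ContinuousLinearMap.single ℂ (fun _ : Fin n => ℂ) i ∘L
      ContinuousLinearMap.proj (R := ℂ) (φ := fun _ : Fin n => ℂ) j ∘L κ)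

lemma sylvesterMatrix_mulVec (G : X →L[ℂ] X) (y : Fin n → ℂ) :
    (sylvesterMatrix κ ι G).mulVec y = y + κ (G (ι y)) := by
  rw [sylvesterMatrix, Matrix.add_mulVec, Matrix.one_mulVec, LinearMap.toMatrix'_mulVec]
  rfl

lemma sylvesterAdjugate_apply (G : X →L[ℂ] X) (x : X) :
    sylvesterAdjugate κ ι G x = (sylvesterMatrix κ ι G).det • x -
      G (ι ((sylvesterMatrix κ ι G).adjugate.mulVec (κ x))) := by
  have : (sylvesterMatrix κ ι G).adjugate.mulVec (κ x) = ∑ i, ∑ j,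
      (sylvesterMatrix κ ι G).adjugate i j • (Pi.single i (κ x j) : Fin n → ℂ) := by
    ext l
    simp [Matrix.mulVec, dotProduct, Finset.sum_apply, Pi.single_apply]
  rw [this]
  simp [sylvesterAdjugate, map_sum]

variable {k : X →L[ℂ] X} (G : X →L[ℂ] X)

lemma one_add_mul_sylvesterAdjugate (hk : ∀ x, k x = ι (κ x)) :
    (1 + G * k) * sylvesterAdjugate κ ι G = (sylvesterMatrix κ ι G).det • 1 := by
  ext x
  set a := (sylvesterMatrix κ ι G).adjugate.mulVec (κ x) with ha
  have h : a + κ (G (ι a)) = (sylvesterMatrix κ ι G).det • κ x := by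
    rw [← sylvesterMatrix_mulVec, ha, Matrix.mulVec_mulVec, Matrix.mul_adjugate,
      Matrix.smul_mulVec, Matrix.one_mulVec]
  have h' := congrArg (fun y => G (ι y)) h
  simp only [map_add, map_smul] at h'
  have h1 : ((1 + G * k) * sylvesterAdjugate κ ι G) x =
      sylvesterAdjugate κ ι G x + G (k (sylvesterAdjugate κ ι G x)) := rfl
  have h2 : ((sylvesterMatrix κ ι G).det • (1 : X →L[ℂ] X)) x =
      (sylvesterMatrix κ ι G).det • x := rfl
  rw [h1, h2, sylvesterAdjugate_apply, ← ha, hk]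
  simp only [map_sub, map_smul]
  rw [← h']
  abel

lemma sylvesterAdjugate_mul_one_add (hk : ∀ x, k x = ι (κ x)) :
    sylvesterAdjugate κ ι G * (1 + G * k) = (sylvesterMatrix κ ι G).det • 1 := by
  ext x
  have h : (sylvesterMatrix κ ι G).adjugate.mulVec (κ x + κ (G (ι (κ x)))) =
      (sylvesterMatrix κ ι G).det • κ x := by
    rw [← sylvesterMatrix_mulVec, Matrix.mulVec_mulVec, Matrix.adjugate_mul,
      Matrix.smul_mulVec, Matrix.one_mulVec]
  have h1 : (sylvesterAdjugate κ ι G * (1 + G * k)) x =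
      sylvesterAdjugate κ ι G (x + G (k x)) := rfl
  have h2 : ((sylvesterMatrix κ ι G).det • (1 : X →L[ℂ] X)) x =
      (sylvesterMatrix κ ι G).det • x := rfl
  rw [h1, h2, sylvesterAdjugate_apply, hk, map_add κ, h]
  simp only [map_smul, smul_add]
  abel

/-- If `y` is in the kernel of `1 + κ G ι`, then `G (ι y)` is in the kernel of `1 + G ι κ`. -/
lemma det_sylvesterMatrix_ne_zero (hk : ∀ x, k x = ι (κ x)) (h : IsUnit (1 + G * k)) :
    (sylvesterMatrix κ ι G).det ≠ 0 := by
  intro h0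
  obtain ⟨y, hy, hy0⟩ := Matrix.exists_mulVec_eq_zero_iff.2 h0
  rw [sylvesterMatrix_mulVec] at hy0
  have h1 : (1 + G * k) (G (ι y)) = 0 := by
    change G (ι y) + G (k (G (ι y))) = 0
    rw [hk, ← map_add, ← map_add, hy0, map_zero, map_zero]
  obtain ⟨D, hD⟩ := h
  have h2 : G (ι y) = 0 := by
    have h3 : ((↑D⁻¹ : X →L[ℂ] X) * ↑D) (G (ι y)) = 0 := by
      change (↑D⁻¹ : X →L[ℂ] X) ((D : X →L[ℂ] X) (G (ι y))) = 0
      rw [hD, h1, map_zero]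
    rwa [Units.inv_mul] at h3
  rw [h2, map_zero, add_zero] at hy0
  exact hy hy0

end Determinant

lemma differentiableAt_sylvesterMatrix {n : ℕ} (κ : X →L[ℂ] (Fin n → ℂ))
    (ι : (Fin n → ℂ) →L[ℂ] X) {G : ℂ → X →L[ℂ] X} {x : ℂ} (hG : DifferentiableAt ℂ G x)
    (i j : Fin n) : DifferentiableAt ℂ (fun z => sylvesterMatrix κ ι (G z) i j) x := by
  simp only [sylvesterMatrix, Matrix.add_apply, LinearMap.toMatrix'_apply]
  refine (differentiableAt_const _).add ?_
  have h : DifferentiableAt ℂ (fun z => κ (G z (ι (Pi.single j 1)))) x :=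
    κ.differentiableAt.comp x (hG.clm_apply (differentiableAt_const _))
  have := differentiableAt_pi.1 h i
  simpa [Pi.single_apply, Function.comp_def, ← Pi.single_apply] using this

lemma differentiableAt_sylvesterAdjugate {n : ℕ} (κ : X →L[ℂ] (Fin n → ℂ))
    (ι : (Fin n → ℂ) →L[ℂ] X) {G : ℂ → X →L[ℂ] X} {x : ℂ} (hG : DifferentiableAt ℂ G x) :
    DifferentiableAt ℂ (fun z => sylvesterAdjugate κ ι (G z)) x := by
  have hm := differentiableAt_sylvesterMatrix κ ι hG
  unfold sylvesterAdjugate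
  refine ((differentiableAt_det hm).smul_const _).sub ?_
  refine DifferentiableAt.fun_sum fun i _ => DifferentiableAt.fun_sum fun j _ => ?_
  exact (differentiableAt_adjugate hm i j).smul (hG.clm_comp (differentiableAt_const _))

end Fredholm

section FredholmFamily

variable {X : Type*} [NormedAddCommGroup X] [InnerProductSpace ℂ X] [CompleteSpace X]
  {A : ℂ → X →L[ℂ] X}

/-- Local form of the analytic Fredholm theorem: near a point where its value is Fredholm, a
holomorphic family is either nowhere invertible or has a meromorphic inverse. -/
lemma eventually_not_isUnit_or_hasInverseOrder {b : ℂ} (hA : AnalyticAt ℂ A b)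
    (hF : (A b).IsFredholm) :
    (∀ᶠ z in 𝓝[≠] b, ¬IsUnit (A z)) ∨ ∃ p, HasInverseOrder A b p := by
  by_cases hfreq : ∃ᶠ z in 𝓝 b, IsUnit (A z)
  swap
  · exact Or.inl ((not_frequently.1 hfreq).filter_mono nhdsWithin_le_nhds)
  have hcl : A b ∈ closure {U : X →L[ℂ] X | IsUnit U} :=
    mem_closure_iff_frequently.2 (hA.continuousAt.tendsto.frequently hfreq)
  obtain ⟨H, k, hH, hk, hAb⟩ := exists_isUnit_add_finiteRank hF hcl
  obtain ⟨n, κ, ι, hκι⟩ := exists_factorization_of_finiteRank hk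
  have hN : AnalyticAt ℂ (fun z => A z - k) b := hA.sub analyticAt_const
  have hNb : IsUnit (A b - k) := by rwa [hAb, add_sub_cancel_right]
  set G : ℂ → X →L[ℂ] X := fun z => Ring.inverse (A z - k)
  have hG : AnalyticAt ℂ G b := analyticAt_inverse_comp hN hNb
  have hNev : ∀ᶠ z in 𝓝 b, IsUnit (A z - k) := eventually_isUnit_of_isUnit hN.continuousAt hNb
  have hGd := Complex.analyticAt_iff_eventually_differentiableAt.1 hG
  set d : ℂ → ℂ := fun z => (sylvesterMatrix κ ι (G z)).det
  set B : ℂ → X →L[ℂ] X := fun z => sylvesterAdjugate κ ι (G z)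
  have hd : AnalyticAt ℂ d b := Complex.analyticAt_iff_eventually_differentiableAt.2
    (hGd.mono fun z hz => differentiableAt_det (differentiableAt_sylvesterMatrix κ ι hz))
  have hB : AnalyticAt ℂ B b := Complex.analyticAt_iff_eventually_differentiableAt.2
    (hGd.mono fun z hz => differentiableAt_sylvesterAdjugate κ ι hz)
  -- `A = (A - k) (1 + G k)`, where the second factor has determinant `d`.
  have hfac : ∀ z, IsUnit (A z - k) → A z = (A z - k) * (1 + G z * k) := fun z hz => by
    rw [mul_add, ← mul_assoc, Ring.mul_inverse_cancel _ hz]; simp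
  by_cases hd0 : ∀ᶠ z in 𝓝 b, d z = 0
  · left
    refine Eventually.filter_mono nhdsWithin_le_nhds ?_
    filter_upwards [hd0, hNev] with z hz hNz hAz
    refine det_sylvesterMatrix_ne_zero κ ι (G z) hκι ?_ hz
    have : 1 + G z * k = G z * A z := by
      rw [hfac z hNz, ← mul_assoc, Ring.inverse_mul_cancel _ hNz, one_mul]
    rw [this]
    exact hNz.ringInverse.mul hAz
  · right
    obtain ⟨p, g, hg, hgb, hdg⟩ := hd.exists_eventuallyEq_pow_smul_nonzero_iff.2 hd0
    refine ⟨p, fun z => (g z)⁻¹ • (B z * G z), (hg.inv hgb).smul (hB.mul hG), ?_⟩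
    refine Eventually.filter_mono nhdsWithin_le_nhds ?_
    filter_upwards [hdg, hNev, hg.continuousAt.eventually_ne hgb] with z hz hNz hgz
    have h1 := one_add_mul_sylvesterAdjugate κ ι (G z) hκι
    have h2 := sylvesterAdjugate_mul_one_add κ ι (G z) hκι
    have h3 : (sylvesterMatrix κ ι (G z)).det = (z - b) ^ p * g z := hz
    have h4 : (g z)⁻¹ * ((z - b) ^ p * g z) = (z - b) ^ p := by field_simp
    rw [hfac z hNz]
    constructor
    · calc (A z - k) * (1 + G z * k) * ((g z)⁻¹ • (B z * G z))
          = (g z)⁻¹ • ((A z - k) * ((1 + G z * k) * B z) * G z) := by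
            rw [mul_smul_comm]; simp only [mul_assoc]
        _ = (z - b) ^ p • ((A z - k) * G z) := by
            rw [h1, mul_smul_comm, mul_one, smul_mul_assoc, smul_smul, h3, h4]
        _ = _ := by rw [Ring.mul_inverse_cancel _ hNz]
    · calc ((g z)⁻¹ • (B z * G z)) * ((A z - k) * (1 + G z * k))
          = (g z)⁻¹ • (B z * (G z * (A z - k)) * (1 + G z * k)) := by
            rw [smul_mul_assoc]; simp only [mul_assoc]
        _ = _ := by
            rw [Ring.inverse_mul_cancel _ hNz, mul_one, h2, smul_smul, h3, h4]

/-- An entire Fredholm family with one invertible value has a meromorphic inverse on the whole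
plane: the set of points near which the inverse is meromorphic is open, closed and nonempty. -/
lemma exists_hasInverseOrder (hA : Differentiable ℂ A) (hF : ∀ z, (A z).IsFredholm) {z₀ : ℂ}
    (hz₀ : IsUnit (A z₀)) (b : ℂ) : ∃ p, HasInverseOrder A b p := by
  have han : ∀ z, AnalyticAt ℂ A z := fun z => hA.analyticAt z
  set S : Set ℂ := {b | ∃ p, HasInverseOrder A b p}
  have hunit : ∀ {z}, IsUnit (A z) → z ∈ S := fun {z} h => ⟨0, .of_isUnit (han z) h⟩
  have hopen : IsOpen S := by
    refine isOpen_iff_mem_nhds.2 fun b ⟨p, hp⟩ => ?_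
    have h := eventually_nhdsWithin_iff.1 hp.eventually_isUnit
    filter_upwards [h] with z hz
    by_cases hzb : z = b
    · exact hzb ▸ ⟨p, hp⟩
    · exact hunit (hz hzb)
  have hclosed : IsOpen Sᶜ := by
    refine isOpen_iff_mem_nhds.2 fun b hb => ?_
    have h := (eventually_not_isUnit_or_hasInverseOrder (han b) (hF b)).resolve_right hb
    have h' := eventually_nhdsWithin_iff.1 h
    filter_upwards [eventually_eventually_nhds.2 h'] with z hz
    by_cases hzb : z = b
    · exact hzb ▸ hb
    · rintro ⟨p, hp⟩
      have h1 : ∀ᶠ y in 𝓝[≠] z, y ≠ b :=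
        (eventually_ne_nhds hzb).filter_mono nhdsWithin_le_nhds
      obtain ⟨y, ⟨hy1, hy2⟩, hy3⟩ :=
        ((hp.eventually_isUnit.and h1).and (hz.filter_mono nhdsWithin_le_nhds)).exists
      exact hy3 hy2 hy1
  have : S = Set.univ := IsClopen.eq_univ ⟨isOpen_compl_iff.1 hclosed, hopen⟩ ⟨z₀, hunit hz₀⟩
  exact (this ▸ Set.mem_univ b : b ∈ S)

/-- The singularities of `A⁻¹`: a function `f` bounding the order of the pole of `A⁻¹` at every
point, which vanishes where `A` is invertible and has finitely many nonzero values on every disc. -/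
lemma exists_divisor (hA : Differentiable ℂ A) (hF : ∀ z, (A z).IsFredholm) {z₀ : ℂ}
    (hz₀ : IsUnit (A z₀)) : ∃ f : ℂ → ℕ, (∀ b, HasInverseOrder A b (f b)) ∧
      (∀ b, IsUnit (A b) → f b = 0) ∧ ∀ r, {b ∈ Metric.closedBall z₀ r | f b ≠ 0}.Finite := by
  classical
  have h := exists_hasInverseOrder hA hF hz₀
  choose p hp using h
  refine ⟨fun b => if IsUnit (A b) then 0 else p b, fun b => ?_, fun b hb => if_pos hb,
    fun r => ?_⟩
  · dsimp only
    by_cases hb : IsUnit (A b)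
    · rw [if_pos hb]; exact .of_isUnit (hA.analyticAt b) hb
    · rw [if_neg hb]; exact hp b
  · by_contra hinf
    obtain ⟨x, -, hx⟩ := Set.Infinite.exists_accPt_of_subset_isCompact hinf
      (isCompact_closedBall z₀ r) fun b hb => hb.1
    rw [accPt_iff_frequently_nhdsNE] at hx
    refine hx ((hp x).eventually_isUnit.mono fun z hz hmem => hmem.2 (if_pos hz))

end FredholmFamily

/-! ### Splitting off one elementary factor -/

section Peel

variable {R : Type*} [NormedRing R] [NormedAlgebra ℂ R]

/-- If the values of `A` at `a` lie in the kernel of left multiplication by the idempotent `P`,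
then `A` is divisible on the left by the elementary factor with zero `a` and projection `P`. If
moreover `P` is as large as possible (`hker`), then the quotient has a pole of the inverse of
smaller order at `a`: the leading coefficient of `A⁻¹` at `a` annihilates `1 - P`. -/
lemma exists_left_quotient {A : ℂ → R} (hA : Differentiable ℂ A) {P : R} (hP : IsIdempotentElem P)
    {z₀ a : ℂ} (ha : a ≠ z₀) (n : ℕ) (hPA : P * A a = 0)
    (hker : ∀ B, B * A a = 0 → B * (1 - P) = 0) [CompleteSpace R] :
    ∃ A₁ : ℂ → R, Differentiable ℂ A₁ ∧
      (∀ z, A z = scaleOn P (scalarFactor n ((z - z₀) / (a - z₀))) * A₁ z) ∧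
      (∀ z, ∃ C, A₁ z - A z = P * C) ∧
      ∀ b p, HasInverseOrder A b p → HasInverseOrder A₁ b (if b = a then p - 1 else p) := by
  have hPP : P * P = P := hP
  have hslope : Differentiable ℂ (dslope A a) := by
    rw [← differentiableOn_univ, Complex.differentiableOn_dslope univ_mem]
    exact hA.differentiableOn
  set E : ℂ → R := fun z => scaleOn P (scalarFactor n ((z - z₀) / (a - z₀))) with hE
  have hEd : Differentiable ℂ E :=
    ((differentiable_scalarFactor z₀ a n).smul_const P).const_add _
  set g := scalarCofactor z₀ a n
  have hg : ∀ z, g z ≠ 0 := scalarCofactor_ne_zero ha n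
  -- Since `P * A` vanishes at `a`, it equals `(z - a) • (P * dslope A a)`; here the scalar `z - a`
  -- is replaced by the quotient of `z - a` by the scalar factor.
  set A₁ : ℂ → R := fun z => (1 - P) * A z - (g z)⁻¹ • (P * dslope A a z) with hA₁
  have hA₁d : Differentiable ℂ A₁ :=
    ((differentiable_const _).mul hA).sub
      (((differentiable_scalarCofactor z₀ a n).inv hg).smul ((differentiable_const _).mul hslope))
  have hmul : ∀ z, A z = E z * A₁ z := by
    intro z
    have h1 : (z - a) • (P * dslope A a z) = P * A z := by
      rw [← mul_smul_comm, sub_smul_dslope, mul_sub, hPA, sub_zero]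
    have h2 : scalarFactor n ((z - z₀) / (a - z₀)) * (g z)⁻¹ = -(z - a) := by
      rw [scalarFactor_eq_mul_cofactor ha, mul_assoc, mul_inv_cancel₀ (hg z)]; ring
    have h3 : ∀ e : ℂ, scaleOn P e * A₁ z =
        (1 - P) * A z - (e * (g z)⁻¹) • (P * dslope A a z) := by
      intro e
      simp only [hA₁, scaleOn, mul_sub, add_mul, sub_mul, one_mul, smul_mul_assoc,
        mul_smul_comm, ← mul_assoc, hPP]
      rw [mul_comm e, ← smul_smul]
      noncomm_ring
    rw [hE, h3, h2, neg_smul, h1, sub_mul, one_mul]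
    abel
  refine ⟨A₁, hA₁d, hmul, fun z => ⟨-(A z) - (g z)⁻¹ • dslope A a z, ?_⟩, ?_⟩
  · simp only [hA₁, mul_sub, mul_neg, mul_smul_comm, sub_mul, one_mul]
    abel
  · -- The inverse of `A₁` is `A⁻¹ * E`; at `a` the product `B * E` vanishes and can be divided by
    -- `z - a`.
    intro b p hb
    obtain ⟨B, hBa, hB, -, hBb⟩ := hb.exists_mul_eq (hA b).continuousAt
    have hEa : E a = 1 - P := by simp [hE, scaleOn, scalarFactor_self ha]
    have hCa : AnalyticAt ℂ (fun z => B z * E z) b := hBa.mul (hEd.analyticAt b)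
    have hne : ∀ᶠ z in 𝓝[≠] b, z ≠ a := by
      by_cases hba : b = a
      · exact hba ▸ self_mem_nhdsWithin
      · exact (eventually_ne_nhds hba).filter_mono nhdsWithin_le_nhds
    have hC : ∀ᶠ z in 𝓝[≠] b, A₁ z * (B z * E z) = (z - b) ^ p • (1 : R) ∧
        (B z * E z) * A₁ z = (z - b) ^ p • (1 : R) := by
      filter_upwards [hB, hne] with z ⟨h1, h2⟩ hz
      refine ⟨?_, by rw [mul_assoc, ← hmul, h2]⟩
      have hu : IsUnit (E z) := isUnit_scaleOn hP (scalarFactor_ne_zero ha n hz)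
      refine hu.mul_left_cancel ?_
      rw [← mul_assoc, ← hmul, ← mul_assoc, h1, smul_mul_assoc, one_mul, mul_smul_comm, mul_one]
    by_cases hba : b = a
    swap
    · rw [if_neg hba]
      exact ⟨_, hCa, hC⟩
    rw [if_pos hba]
    subst hba
    cases p with
    | zero => exact ⟨_, hCa, hC⟩
    | succ q =>
      have h0 : B b * E b = 0 := by
        rw [hEa]
        exact hker _ (by simpa using hBb)
      refine ⟨dslope (fun z => B z * E z) b, ?_, ?_⟩
      · obtain ⟨s, hs, hsd⟩ := Complex.analyticAt_iff_eventually_differentiableAt.1 hCa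
          |>.exists_mem
        have h1 : DifferentiableOn ℂ (fun z => B z * E z) s :=
          fun z hz => (hsd z hz).differentiableWithinAt
        exact ((Complex.differentiableOn_dslope hs).2 h1).analyticAt hs
      · filter_upwards [hC, self_mem_nhdsWithin] with z ⟨h1, h2⟩ hz
        have hz' : z - b ≠ 0 := sub_ne_zero.2 hz
        have h3 : dslope (fun z => B z * E z) b z = (z - b)⁻¹ • (B z * E z) := by
          rw [dslope_of_ne _ hz, slope_def_module, h0, sub_zero]
        have h4 : (z - b)⁻¹ * (z - b) ^ (q + 1) = (z - b) ^ q := by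
          rw [pow_succ]; field_simp
        rw [h3, mul_smul_comm, h1, smul_mul_assoc, h2, smul_smul, h4]
        exact ⟨rfl, rfl⟩

lemma HasInverseOrder.op {A : ℂ → R} {b : ℂ} {p : ℕ} (h : HasInverseOrder A b p) :
    HasInverseOrder (fun z => MulOpposite.op (A z)) b p := by
  obtain ⟨B, hBa, hB⟩ := h
  refine ⟨fun z => MulOpposite.op (B z),
    ((MulOpposite.opContinuousLinearEquiv ℂ (M := R)).toContinuousLinearMap.analyticAt
      (B b)).comp hBa, ?_⟩
  filter_upwards [hB] with z ⟨h1, h2⟩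
  rw [← MulOpposite.op_mul, ← MulOpposite.op_mul, h1, h2]
  exact ⟨rfl, rfl⟩

lemma HasInverseOrder.unop {A : ℂ → Rᵐᵒᵖ} {b : ℂ} {p : ℕ} (h : HasInverseOrder A b p) :
    HasInverseOrder (fun z => MulOpposite.unop (A z)) b p := by
  obtain ⟨B, hBa, hB⟩ := h
  refine ⟨fun z => MulOpposite.unop (B z),
    ((MulOpposite.opContinuousLinearEquiv ℂ (M := R)).symm.toContinuousLinearMap.analyticAt
      (B b)).comp hBa, ?_⟩
  filter_upwards [hB] with z ⟨h1, h2⟩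
  rw [← MulOpposite.unop_mul, ← MulOpposite.unop_mul, h1, h2]
  exact ⟨rfl, rfl⟩

/-- The mirror image of `exists_left_quotient`, obtained from it in the opposite ring. -/
lemma exists_right_quotient {A : ℂ → R} (hA : Differentiable ℂ A) {P : R}
    (hP : IsIdempotentElem P) {z₀ a : ℂ} (ha : a ≠ z₀) (n : ℕ) (hPA : A a * P = 0)
    (hker : ∀ B, A a * B = 0 → (1 - P) * B = 0) [CompleteSpace R] :
    ∃ A₁ : ℂ → R, Differentiable ℂ A₁ ∧
      (∀ z, A z = A₁ z * scaleOn P (scalarFactor n ((z - z₀) / (a - z₀)))) ∧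
      (∀ z, ∃ C, A₁ z - A z = C * P) ∧
      ∀ b p, HasInverseOrder A b p → HasInverseOrder A₁ b (if b = a then p - 1 else p) := by
  obtain ⟨A₁, hd, hmul, hsub, hord⟩ := exists_left_quotient
    (A := fun z => MulOpposite.op (A z)) (P := MulOpposite.op P)
    ((MulOpposite.opContinuousLinearEquiv ℂ (M := R)).toContinuousLinearMap.differentiable.comp hA)
    (congrArg MulOpposite.op hP) ha n (congrArg MulOpposite.op hPA)
    fun B hB => congrArg MulOpposite.op (hker B.unop (congrArg MulOpposite.unop hB))
  refine ⟨fun z => (A₁ z).unop,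
    (MulOpposite.opContinuousLinearEquiv ℂ (M := R)).symm.toContinuousLinearMap.differentiable.comp
      hd, fun z => congrArg MulOpposite.unop (hmul z), fun z => ?_,
    fun b p hb => (hord b p hb.op).unop⟩
  obtain ⟨C, hC⟩ := hsub z
  exact ⟨C.unop, congrArg MulOpposite.unop hC⟩

end Peel

section Operator

variable {X : Type*} [NormedAddCommGroup X] [InnerProductSpace ℂ X]

lemma hasNoetherianRange_of_finiteDimensional {P : X →L[ℂ] X} (h : FiniteDimensional ℂ P.range) :
    (P : X →ₗ[ℂ] X).HasNoetherianRange :=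
  IsNoetherian.iff_fg.2 h

variable [CompleteSpace X] {A : ℂ → X →L[ℂ] X}

/-- An entire Fredholm family is divisible on the left by the elementary factor at `a` whose
projection has range the orthogonal complement of the range of `A a`. -/
lemma exists_left_elementaryFactor (hA : Differentiable ℂ A) (hF : ∀ z, (A z).IsFredholm)
    {z₀ a : ℂ} (ha : a ≠ z₀) (n : ℕ) :
    ∃ (P : X →L[ℂ] X) (A₁ : ℂ → X →L[ℂ] X), IsStarProjection P ∧ FiniteDimensional ℂ P.range ∧
      Differentiable ℂ A₁ ∧ (∀ z, (A₁ z).IsFredholm) ∧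
      (∀ z, A z = elementaryFactor P n ((z - z₀) / (a - z₀)) * A₁ z) ∧
      ∀ b p, HasInverseOrder A b p → HasInverseOrder A₁ b (if b = a then p - 1 else p) := by
  set K : Submodule ℂ X := (A a).range
  have hKc : IsClosed (K : Set X) := (hF a).isClosed_range
  have : CompleteSpace K := hKc.completeSpace_coe
  have hfin : FiniteDimensional ℂ Kᗮ := by
    rw [← Submodule.fg_iff_finiteDimensional]
    exact (hF a).finite_coker.fg_of_disjoint K.orthogonal_disjoint.symm
  set P : X →L[ℂ] X := Kᗮ.starProjection
  have hP : IsStarProjection P := isStarProjection_starProjection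
  have hr : FiniteDimensional ℂ P.range := by
    rw [Submodule.range_starProjection]; exact hfin
  have hPA : P * A a = 0 := by
    ext x
    change Kᗮ.starProjection (A a x) = 0
    rw [Submodule.starProjection_apply_eq_zero_iff, Submodule.orthogonal_orthogonal]
    exact ⟨x, rfl⟩
  have hker : ∀ B : X →L[ℂ] X, B * A a = 0 → B * (1 - P) = 0 := by
    intro B hB
    ext x
    have h1 : x - P x ∈ K := by
      have := Kᗮ.sub_starProjection_mem_orthogonal x
      rwa [Submodule.orthogonal_orthogonal] at this
    obtain ⟨y, hy⟩ := h1
    change B (x - P x) = 0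
    rw [← hy]
    exact congrArg (fun T : X →L[ℂ] X => T y) hB
  obtain ⟨A₁, hd, hmul, hsub, hord⟩ :=
    exists_left_quotient hA hP.isIdempotentElem ha n hPA hker
  refine ⟨P, A₁, hP, hr, hd, fun z => isFredholm_of_sub_hasNoetherianRange (hF z) ?_,
    fun z => by rw [elementaryFactor_eq hP.isIdempotentElem, ← hmul], hord⟩
  obtain ⟨C, hC⟩ := hsub z
  rw [hC]
  exact (hasNoetherianRange_of_finiteDimensional hr).comp_right C.toLinearMap

/-- An entire Fredholm family is divisible on the right by the elementary factor at `a` whose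
projection has range the kernel of `A a`. -/
lemma exists_right_elementaryFactor (hA : Differentiable ℂ A) (hF : ∀ z, (A z).IsFredholm)
    {z₀ a : ℂ} (ha : a ≠ z₀) (n : ℕ) :
    ∃ (P : X →L[ℂ] X) (A₁ : ℂ → X →L[ℂ] X), IsStarProjection P ∧ FiniteDimensional ℂ P.range ∧
      Differentiable ℂ A₁ ∧ (∀ z, (A₁ z).IsFredholm) ∧
      (∀ z, A z = A₁ z * elementaryFactor P n ((z - z₀) / (a - z₀))) ∧
      ∀ b p, HasInverseOrder A b p → HasInverseOrder A₁ b (if b = a then p - 1 else p) := by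
  set K : Submodule ℂ X := (A a).ker
  have hfin : FiniteDimensional ℂ K := (hF a).finite_ker
  set P : X →L[ℂ] X := K.starProjection
  have hP : IsStarProjection P := isStarProjection_starProjection
  have hr : FiniteDimensional ℂ P.range := by
    rw [Submodule.range_starProjection]; exact hfin
  have hPA : A a * P = 0 := by
    ext x
    have h : P x ∈ K := K.starProjection_apply_mem x
    exact h
  have hker : ∀ B : X →L[ℂ] X, A a * B = 0 → (1 - P) * B = 0 := by
    intro B hB
    ext x
    have h1 : B x ∈ K := congrArg (fun T : X →L[ℂ] X => T x) hB
    change B x - P (B x) = 0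
    rw [sub_eq_zero, Submodule.starProjection_eq_self_iff.2 h1]
  obtain ⟨A₁, hd, hmul, hsub, hord⟩ :=
    exists_right_quotient hA hP.isIdempotentElem ha n hPA hker
  refine ⟨P, A₁, hP, hr, hd, fun z => isFredholm_of_sub_hasNoetherianRange (hF z) ?_,
    fun z => by rw [elementaryFactor_eq hP.isIdempotentElem, ← hmul], hord⟩
  obtain ⟨C, hC⟩ := hsub z
  rw [hC]
  exact (hasNoetherianRange_of_finiteDimensional hr).comp_left C.toLinearMap

end Operator

/-! ### Convergence of Weierstrass products -/

section Convergence

variable {X : Type*} [NormedAddCommGroup X] [InnerProductSpace ℂ X] [CompleteSpace X]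

/-- The canonical products converge because the degree of the `i`-th factor grows with `i`; the
bound is uniform in the projections. -/
lemma exists_summable_bound {a : ℕ → ℂ} (ha : Tendsto (fun n => ‖a n‖) atTop atTop) (z₀ : ℂ)
    (r : ℝ) : ∃ c : ℕ → ℝ, Summable c ∧ ∀ i, ∀ z ∈ Metric.closedBall z₀ r,
      ∀ P : X →L[ℂ] X, IsStarProjection P →
        ‖elementaryFactor P (i + 1) ((z - z₀) / (a i - z₀)) - 1‖ ≤ c i := by
  obtain ⟨C, hC0, hC⟩ := exists_norm_scalarFactor_sub_one_le (q := 1 / 2) (by norm_num)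
  have hev : ∀ᶠ n in atTop, ‖z₀‖ + (2 * |r| + 1) ≤ ‖a n‖ := ha.eventually_ge_atTop _
  obtain ⟨N, hN⟩ := eventually_atTop.1 hev
  have hM : ∀ i, ∃ M : ℝ, ∀ z ∈ Metric.closedBall z₀ r,
      ‖scalarFactor (i + 1) ((z - z₀) / (a i - z₀)) - 1‖ ≤ M := fun i =>
    (isCompact_closedBall z₀ r).exists_bound_of_continuousOn
      ((differentiable_scalarFactor z₀ (a i) (i + 1)).continuous.sub continuous_const).continuousOn
  choose M hM using hM
  refine ⟨fun i => if i < N then M i else C * (1 / 2) ^ (i + 1), ?_, fun i z hz P hP => ?_⟩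
  · refine (summable_nat_add_iff N).1 ?_
    have : (fun n : ℕ => if n + N < N then M (n + N) else C * (1 / 2 : ℝ) ^ (n + N + 1)) =
        fun n : ℕ => C * (1 / 2) ^ (N + 1) * (1 / 2) ^ n := by
      funext n
      rw [if_neg (by omega)]
      ring
    rw [this]
    exact (summable_geometric_of_lt_one (by norm_num) (by norm_num)).mul_left _
  · refine (norm_elementaryFactor_sub_one_le hP _ _).trans ?_
    dsimp only
    split_ifs with hi
    · exact hM i z hz
    · refine hC _ _ ?_
      have h1 := hN i (not_lt.1 hi)
      have h2 : ‖a i‖ ≤ ‖a i - z₀‖ + ‖z₀‖ := by simpa using norm_add_le (a i - z₀) z₀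
      have h3 : ‖z - z₀‖ ≤ r := by simpa [dist_eq_norm] using hz
      have h4 := le_abs_self r
      rw [norm_div, div_le_iff₀ (by linarith [abs_nonneg r])]
      linarith

variable {z₀ : ℂ} {a : ℕ → ℂ} {P : ℕ → X →L[ℂ] X}

/-- The infinite product with zeros `a i` and projections `P i`. -/
def weierstrassProduct (z₀ : ℂ) (a : ℕ → ℂ) (P : ℕ → X →L[ℂ] X) (z : ℂ) : X →L[ℂ] X :=
  infiniteProd fun i => elementaryFactor (P i) (i + 1) ((z - z₀) / (a i - z₀))

lemma isWeierstrassProduct_weierstrassProduct (ha : Tendsto (fun n => ‖a n‖) atTop atTop)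
    (ha₀ : ∀ n, a n ≠ z₀) (hP : ∀ n, IsStarProjection (P n))
    (hr : ∀ n, FiniteDimensional ℂ (P n).range) :
    IsWeierstrassProduct z₀ (weierstrassProduct z₀ a P) := by
  refine ⟨a, P, ha, ha₀, hP, hr, fun S hS => ?_⟩
  obtain ⟨r, hSr⟩ := hS.subset_closedBall z₀
  obtain ⟨c, hc, hb⟩ := exists_summable_bound (X := X) ha z₀ r
  have h := tendstoUniformlyOn_orderedProd (S := Metric.closedBall z₀ r) hc
    (u := fun i z => elementaryFactor (P i) (i + 1) ((z - z₀) / (a i - z₀)))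
    fun i z hz => hb i z hz (P i) (hP i)
  have e : partialProduct z₀ a P = fun n z => orderedProd
      (fun i => elementaryFactor (P i) (i + 1) ((z - z₀) / (a i - z₀))) n :=
    funext fun n => funext fun z => partialProduct_eq_orderedProd z₀ a P n z
  rw [e]
  exact h.mono hSr

lemma differentiable_weierstrassProduct (ha : Tendsto (fun n => ‖a n‖) atTop atTop)
    (hP : ∀ n, IsStarProjection (P n)) : Differentiable ℂ (weierstrassProduct z₀ a P) := by
  intro z
  obtain ⟨c, hc, hb⟩ := exists_summable_bound (X := X) ha z₀ (dist z z₀ + 1)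
  refine (differentiableOn_infiniteProd Metric.isOpen_ball hc
    (u := fun i z => elementaryFactor (P i) (i + 1) ((z - z₀) / (a i - z₀)))
    (fun i z hz => hb i z (Metric.ball_subset_closedBall hz) (P i) (hP i))
    fun i => (differentiable_elementaryFactor (hP i).isIdempotentElem z₀ (a i)
      (i + 1)).differentiableOn).differentiableAt (Metric.isOpen_ball.mem_nhds ?_)
  simp [Metric.mem_ball]

lemma differentiable_partialProduct (hP : ∀ n, IsStarProjection (P n)) (n : ℕ) :
    Differentiable ℂ (partialProduct z₀ a P n) := by
  have e : partialProduct z₀ a P n = fun z => orderedProd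
      (fun i => elementaryFactor (P i) (i + 1) ((z - z₀) / (a i - z₀))) n :=
    funext fun z => partialProduct_eq_orderedProd z₀ a P n z
  rw [e]
  exact differentiable_orderedProd fun i _ =>
    differentiable_elementaryFactor (hP i).isIdempotentElem z₀ (a i) (i + 1)

lemma isUnit_partialProduct (hP : ∀ n, IsStarProjection (P n)) {n : ℕ} {z : ℂ}
    (ha₀ : ∀ i < n, a i ≠ z₀) (hz : ∀ i < n, z ≠ a i) : IsUnit (partialProduct z₀ a P n z) := by
  rw [partialProduct_eq_orderedProd]
  exact isUnit_orderedProd fun i hi =>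
    isUnit_elementaryFactor (hP i).isIdempotentElem (ha₀ i hi) _ (hz i hi)

end Convergence

/-! ### Zeros split off on the left -/

/-- An enumeration with multiplicities of a locally finite set of points, padded by the points
`z₀ + 1, z₀ + 2, …` to make it infinite in all cases. -/
lemma exists_enumeration {z₀ : ℂ} {f : ℂ → ℕ}
    (hf : ∀ r, {b ∈ Metric.closedBall z₀ r | f b ≠ 0}.Finite) (hf₀ : f z₀ = 0) :
    ∃ a : ℕ → ℂ, (∀ n, a n ≠ z₀) ∧ Tendsto (fun n => ‖a n‖) atTop atTop ∧
      ∀ r, ∃ N, ∀ n ≥ N, a n ∉ Metric.closedBall z₀ r ∧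
        ∀ b ∈ Metric.closedBall z₀ r, f b ≤ ((Finset.range n).filter fun k => a k = b).card := by
  classical
  let T := (Σ b : ℂ, Fin (f b)) ⊕ ℕ
  let loc : T → ℂ := Sum.elim (fun t => t.1) fun j => z₀ + (j + 1)
  have hfin1 : ∀ r, {t : Σ b : ℂ, Fin (f b) | t.1 ∈ Metric.closedBall z₀ r}.Finite := by
    intro r
    refine ((hf r).biUnion fun b _ => Set.finite_range fun i : Fin (f b) =>
      (⟨b, i⟩ : Σ b : ℂ, Fin (f b))).subset ?_
    rintro ⟨b, i⟩ hb
    have h0 : f b ≠ 0 := fun h => (h ▸ i).elim0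
    exact Set.mem_biUnion (x := b) ⟨hb, h0⟩ ⟨i, rfl⟩
  have hfin2 : ∀ r, {j : ℕ | z₀ + (j + 1) ∈ Metric.closedBall z₀ r}.Finite := by
    intro r
    obtain ⟨m, hm⟩ := exists_nat_gt r
    refine (Set.finite_lt_nat m).subset fun j hj => ?_
    have h1 : ‖((j : ℂ) + 1)‖ ≤ r := by simpa [dist_eq_norm] using hj
    have h2 : ‖((j : ℂ) + 1)‖ = j + 1 := by
      have := Complex.norm_natCast (j + 1)
      push_cast at this
      exact this
    have : (j : ℝ) < m := by linarith
    exact_mod_cast this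
  have hfin : ∀ r, {t : T | loc t ∈ Metric.closedBall z₀ r}.Finite := by
    intro r
    refine (((hfin1 r).image Sum.inl).union ((hfin2 r).image Sum.inr)).subset ?_
    rintro (t | j) ht
    · exact Or.inl ⟨t, ht, rfl⟩
    · exact Or.inr ⟨j, ht, rfl⟩
  have : Countable T := by
    rw [← Set.countable_univ_iff]
    have hU : (Set.univ : Set T) ⊆ ⋃ n : ℕ, {t : T | loc t ∈ Metric.closedBall z₀ n} := by
      intro t _
      obtain ⟨n, hn⟩ := exists_nat_ge (dist (loc t) z₀)
      exact Set.mem_iUnion.2 ⟨n, hn⟩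
    exact (Set.countable_iUnion fun n : ℕ => (hfin n).countable).mono hU
  obtain ⟨hd⟩ := nonempty_denumerable T
  let e : T ≃ ℕ := Denumerable.eqv T
  have hfinN : ∀ r, {n : ℕ | loc (e.symm n) ∈ Metric.closedBall z₀ r}.Finite := fun r =>
    Set.Finite.preimage (s := {t : T | loc t ∈ Metric.closedBall z₀ r}) e.symm.injective.injOn
      (hfin r)
  refine ⟨fun n => loc (e.symm n), fun n => ?_, ?_, fun r => ?_⟩
  · change loc (e.symm n) ≠ z₀
    rcases e.symm n with ⟨b, i⟩ | j
    · intro h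
      have h' : b = z₀ := h
      subst h'
      exact (hf₀ ▸ i).elim0
    · intro h
      have h' : z₀ + ((j : ℂ) + 1) = z₀ := h
      exact Nat.cast_add_one_ne_zero j (add_eq_left.1 h')
  · rw [tendsto_atTop]
    intro r
    rw [← Nat.cofinite_eq_atTop, eventually_cofinite]
    refine (hfinN (r + ‖z₀‖)).subset fun n hn => ?_
    have h1 : ‖loc (e.symm n)‖ < r := not_le.1 hn
    change dist (loc (e.symm n)) z₀ ≤ r + ‖z₀‖
    rw [dist_eq_norm]
    exact (norm_sub_le _ _).trans (by linarith)
  · obtain ⟨N, hN⟩ := (hfinN r).bddAbove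
    refine ⟨N + 1, fun n hn => ⟨fun hmem => ?_, fun b hb => ?_⟩⟩
    · have : n ≤ N := hN hmem
      omega
    · have := Finset.card_le_card_of_injOn (s := (Finset.univ : Finset (Fin (f b))))
        (t := (Finset.range n).filter fun k => loc (e.symm k) = b)
        (fun i => e (Sum.inl ⟨b, i⟩)) (fun i _ => ?_) (fun i _ j _ hij => ?_)
      · simpa using this
      · have h1 : loc (e.symm (e (Sum.inl ⟨b, i⟩))) = b := by
          rw [Equiv.symm_apply_apply]; rfl
        have h2 : e (Sum.inl ⟨b, i⟩) ≤ N := hN (by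
          change loc (e.symm _) ∈ Metric.closedBall z₀ r
          rw [h1]; exact hb)
        rw [Finset.mem_coe, Finset.mem_filter, Finset.mem_range]
        exact ⟨lt_of_le_of_lt h2 hn, h1⟩
      · have h1 := Sum.inl_injective (e.injective hij)
        simpa using h1

section LeftFactorization

variable {X : Type*} [NormedAddCommGroup X] [InnerProductSpace ℂ X] [CompleteSpace X]

/-- The quotients `A n` of `A` by the partial products converge, on every disc, to an invertible
function: once all singularities in the disc have been split off, `A n` is obtained from an
invertible function by multiplication with the inverse of a tail of the product. -/
theorem exists_eq_weierstrassProduct_mul {A : ℂ → X →L[ℂ] X} (hA : Differentiable ℂ A)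
    (hF : ∀ z, (A z).IsFredholm) {z₀ : ℂ} (hz₀ : IsUnit (A z₀)) :
    ∃ P E : ℂ → X →L[ℂ] X, IsWeierstrassProduct z₀ P ∧ Differentiable ℂ P ∧
      Differentiable ℂ E ∧ (∀ z, IsUnit (E z)) ∧ ∀ z, A z = P z * E z := by
  obtain ⟨f, hford, hfunit, hffin⟩ := exists_divisor hA hF hz₀
  obtain ⟨a, ha₀, ha, hcount⟩ := exists_enumeration hffin (hfunit z₀ hz₀)
  have hstep : ∀ (n : ℕ) (S : {A : ℂ → X →L[ℂ] X // Differentiable ℂ A ∧ ∀ z, (A z).IsFredholm}),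
      ∃ (P : X →L[ℂ] X) (S' : {A : ℂ → X →L[ℂ] X // Differentiable ℂ A ∧ ∀ z, (A z).IsFredholm}),
        IsStarProjection P ∧ FiniteDimensional ℂ P.range ∧
        (∀ z, S.1 z = elementaryFactor P (n + 1) ((z - z₀) / (a n - z₀)) * S'.1 z) ∧
        ∀ b p, HasInverseOrder S.1 b p → HasInverseOrder S'.1 b (if b = a n then p - 1 else p) := by
    intro n S
    obtain ⟨P, A₁, hP, hr, hd, hF₁, hmul, hord⟩ :=
      exists_left_elementaryFactor S.2.1 S.2.2 (ha₀ n) (n + 1)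
    exact ⟨P, ⟨A₁, hd, hF₁⟩, hP, hr, hmul, hord⟩
  choose Pf Sf hPf hrf hmulf hordf using hstep
  let st : ℕ → {A : ℂ → X →L[ℂ] X // Differentiable ℂ A ∧ ∀ z, (A z).IsFredholm} :=
    fun n => Nat.rec ⟨A, hA, hF⟩ (fun n S => Sf n S) n
  let P : ℕ → X →L[ℂ] X := fun n => Pf n (st n)
  have hP : ∀ n, IsStarProjection (P n) := fun n => hPf n (st n)
  let u : ℕ → ℂ → X →L[ℂ] X := fun i z => elementaryFactor (P i) (i + 1) ((z - z₀) / (a i - z₀))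
  have hmul : ∀ n z, (st n).1 z = u n z * (st (n + 1)).1 z := fun n z => hmulf n (st n) z
  have hprod : ∀ z N n, (st N).1 z = orderedProd (fun k => u (N + k) z) n * (st (N + n)).1 z := by
    intro z N n
    induction n with
    | zero => simp
    | succ n ih => rw [ih, hmul, orderedProd_succ, mul_assoc, ← add_assoc]
  have hord : ∀ n b, HasInverseOrder (st n).1 b
      (f b - ((Finset.range n).filter fun k => a k = b).card) := by
    intro n b
    induction n with
    | zero => exact hford b
    | succ n ih =>
      have := hordf n (st n) b _ ih
      rw [Finset.range_add_one, Finset.filter_insert]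
      by_cases hb : a n = b
      · rw [if_pos hb.symm] at this
        rw [if_pos hb, Finset.card_insert_of_notMem (by simp), ← Nat.sub_sub]
        exact this
      · rw [if_neg (Ne.symm hb)] at this
        rwa [if_neg hb]
  have hlim : ∀ r : ℝ, ∃ H : ℂ → X →L[ℂ] X, DifferentiableOn ℂ H (Metric.ball z₀ r) ∧
      ∀ z ∈ Metric.ball z₀ r, IsUnit (H z) ∧ Tendsto (fun n => (st n).1 z) atTop (𝓝 (H z)) := by
    intro r
    obtain ⟨N, hN⟩ := hcount r
    obtain ⟨c, hc, hb⟩ := exists_summable_bound (X := X) ha z₀ r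
    have hc' : Summable fun k => c (N + k) := by
      simpa only [add_comm] using (summable_nat_add_iff N).2 hc
    have hu : ∀ k, ∀ z ∈ Metric.ball z₀ r, ‖u (N + k) z - 1‖ ≤ c (N + k) := fun k z hz =>
      hb _ z (Metric.ball_subset_closedBall hz) _ (hP _)
    have huu : ∀ k, ∀ z ∈ Metric.ball z₀ r, IsUnit (u (N + k) z) := fun k z hz =>
      isUnit_elementaryFactor (hP _).isIdempotentElem (ha₀ _) _ fun h =>
        (hN (N + k) (Nat.le_add_right _ _)).1 (h ▸ Metric.ball_subset_closedBall hz)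
    have hTu : ∀ z ∈ Metric.ball z₀ r, IsUnit (infiniteProd fun k => u (N + k) z) :=
      fun z hz => isUnit_infiniteProd hc' (fun k => hu k z hz) fun k => huu k z hz
    have hTd := differentiableOn_infiniteProd Metric.isOpen_ball hc' (u := fun k => u (N + k)) hu
      fun k => (differentiable_elementaryFactor (hP _).isIdempotentElem z₀ (a _) _).differentiableOn
    refine ⟨fun z => Ring.inverse (infiniteProd fun k => u (N + k) z) * (st N).1 z, ?_,
      fun z hz => ⟨?_, ?_⟩⟩
    · intro z hz
      have h1 := analyticAt_inverse_comp
        (hTd.analyticAt (Metric.isOpen_ball.mem_nhds hz)) (hTu z hz)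
      exact (h1.differentiableAt.mul ((st N).2.1 z)).differentiableWithinAt
    · refine (hTu z hz).ringInverse.mul (HasInverseOrder.isUnit ?_ ((st N).2.1 z).continuousAt)
      have := hord N z
      rwa [Nat.sub_eq_zero_of_le ((hN N le_rfl).2 z (Metric.ball_subset_closedBall hz))] at this
    · rw [← tendsto_add_atTop_iff_nat N]
      have h1 := tendsto_orderedProd hc' fun k => hu k z hz
      obtain ⟨t, ht⟩ := hTu z hz
      have h2 := (NormedRing.inverse_continuousAt t).tendsto
      rw [ht] at h2
      refine ((h2.comp h1).mul_const ((st N).1 z)).congr fun n => ?_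
      have h3 : IsUnit (orderedProd (fun k => u (N + k) z) n) :=
        isUnit_orderedProd fun k _ => huu k z hz
      rw [Function.comp_apply, hprod z N n, ← mul_assoc, Ring.inverse_mul_cancel _ h3, one_mul,
        add_comm n N]
  obtain ⟨E, hEd, hE⟩ := exists_entire_limit hlim
  refine ⟨weierstrassProduct z₀ a P, E,
    isWeierstrassProduct_weierstrassProduct ha ha₀ hP fun n => hrf n (st n),
    differentiable_weierstrassProduct ha hP, hEd, fun z => (hE z).1, fun z => ?_⟩
  obtain ⟨c, hc, hb⟩ := exists_summable_bound (X := X) ha z₀ (dist z z₀)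
  have h1 := tendsto_orderedProd hc (u := fun i => u i z)
    fun i => hb i z (Metric.mem_closedBall.2 le_rfl) _ (hP i)
  refine tendsto_nhds_unique (tendsto_const_nhds.congr fun n => ?_) (h1.mul (hE z).2)
  have := hprod z 0 n
  simp only [zero_add] at this
  exact this

end LeftFactorization

/-! ### Moving a nearly trivial factor to the left of a product -/

section Perturbation

variable {X : Type*} [NormedAddCommGroup X] [InnerProductSpace ℂ X]

lemma partialProduct_congr {z₀ : ℂ} {a a' : ℕ → ℂ} {P P' : ℕ → X →L[ℂ] X} {n : ℕ}
    (ha : ∀ i < n, a i = a' i) (hP : ∀ i < n, P i = P' i) (z : ℂ) :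
    partialProduct z₀ a P n z = partialProduct z₀ a' P' n z := by
  rw [partialProduct_eq_orderedProd, partialProduct_eq_orderedProd]
  exact orderedProd_congr fun i hi => by rw [ha i hi, hP i hi]

variable [CompleteSpace X]

/-- If `W` is close to `1`, the inverse image under `W` of the range of `P` is the range of an
orthogonal projection close to `P`. -/
lemma exists_projection_near {P : X →L[ℂ] X} (hP : IsStarProjection P)
    (hr : FiniteDimensional ℂ P.range) {W : X →L[ℂ] X} {η : ℝ} (hη : η ≤ 1 / 2)
    (hW : ‖W - 1‖ ≤ η) :
    ∃ P' : X →L[ℂ] X, IsStarProjection P' ∧ FiniteDimensional ℂ P'.range ∧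
      ‖P' - P‖ ≤ 3 * η ∧ (1 - P) * W * P' = 0 := by
  have hWu : IsUnit W := isUnit_of_norm_sub_one_lt_one (by linarith)
  set V := Ring.inverse W
  have hV : ‖V - 1‖ ≤ 2 * η := norm_inverse_sub_one_le hη hW
  have hWV : W * V = 1 := Ring.mul_inverse_cancel W hWu
  have hPP : P * P = P := hP.isIdempotentElem
  set K : Submodule ℂ X := (V * P).range
  have hK : FiniteDimensional ℂ K := (IsNoetherian.iff_fg.1
    ((hasNoetherianRange_of_finiteDimensional hr).comp_left V.toLinearMap) :)
  set P' : X →L[ℂ] X := K.starProjection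
  have hP' : IsStarProjection P' := isStarProjection_starProjection
  have hr' : FiniteDimensional ℂ P'.range := by
    rw [Submodule.range_starProjection]; exact hK
  have h1 : (1 - P') * V * P = 0 := by
    ext x
    change V (P x) - P' (V (P x)) = 0
    rw [sub_eq_zero, Submodule.starProjection_eq_self_iff.2 (show V (P x) ∈ K from ⟨x, rfl⟩)]
  have h2 : (1 - P) * W * P' = 0 := by
    ext x
    obtain ⟨y, hy⟩ := K.starProjection_apply_mem x
    change (1 - P) (W (P' x)) = 0
    have h3 : P' x = V (P y) := hy.symm
    have h4 : W (V (P y)) = P y := congrArg (fun T : X →L[ℂ] X => T (P y)) hWV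
    have h5 : P (P y) = P y := congrArg (fun T : X →L[ℂ] X => T y) hPP
    rw [h3, h4]
    change P y - P (P y) = 0
    rw [h5, sub_self]
  refine ⟨P', hP', hr', ?_, h2⟩
  have hn : ∀ {Q : X →L[ℂ] X}, IsStarProjection Q → ‖Q‖ ≤ 1 := fun hQ =>
    IsStarProjection.norm_le _ hQ
  have hsandwich : ∀ {Q₁ Q₂ D : X →L[ℂ] X}, IsStarProjection Q₁ → IsStarProjection Q₂ →
      ‖Q₁ * D * Q₂‖ ≤ ‖D‖ := by
    intro Q₁ Q₂ D h₁ h₂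
    calc _ ≤ ‖Q₁‖ * ‖D‖ * ‖Q₂‖ :=
          (norm_mul_le _ _).trans (by gcongr; exact norm_mul_le _ _)
      _ ≤ 1 * ‖D‖ * 1 := by gcongr; exacts [hn h₁, hn h₂]
      _ = ‖D‖ := by ring
  have h3 : ‖(1 - P') * P‖ ≤ 2 * η := by
    have : (1 - P') * P = (1 - P') * V * P - (1 - P') * (V - 1) * P := by noncomm_ring
    rw [this, h1, zero_sub, norm_neg]
    exact (hsandwich hP'.one_sub hP).trans hV
  have h4 : ‖P' * (1 - P)‖ ≤ η := by
    have h5 : (1 - P) * P' = (1 - P) * W * P' - (1 - P) * (W - 1) * P' := by noncomm_ring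
    have h6 : P' * (1 - P) = star ((1 - P) * P') := by
      rw [star_mul, hP'.isSelfAdjoint.star_eq, hP.one_sub.isSelfAdjoint.star_eq]
    rw [h6, norm_star, h5, h2, zero_sub, norm_neg]
    exact (hsandwich hP.one_sub hP').trans hW
  have h7 : P' - P = P' * (1 - P) - (1 - P') * P := by noncomm_ring
  rw [h7]
  exact (norm_sub_le _ _).trans (by linarith)

lemma norm_scaleOn_le {P : X →L[ℂ] X} (hP : IsStarProjection P) (x : ℂ) :
    ‖scaleOn P x‖ ≤ 1 + ‖x‖ := by
  refine (norm_add_le _ _).trans (add_le_add (IsStarProjection.norm_le _ hP.one_sub) ?_)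
  rw [norm_smul]
  exact mul_le_of_le_one_right (norm_nonneg _) (IsStarProjection.norm_le _ hP)

variable {z₀ : ℂ} {ρ : ℝ}

/-- An elementary factor times a function close to `1` is a function close to `1` times an
elementary factor with the same zero and a nearby projection. The new left factor is estimated on
the boundary circle, where the elementary factors are invertible, and then on the disc by the
maximum principle. -/
lemma exists_elementaryFactor_mul_eq {a : ℂ} (ha : a ∈ Metric.ball z₀ ρ) (ha₀ : a ≠ z₀)
    {P : X →L[ℂ] X} (hP : IsStarProjection P) (hr : FiniteDimensional ℂ P.range) (n : ℕ) {ε : ℝ}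
    (hε : 0 < ε) :
    ∃ δ > 0, ∀ T : ℂ → X →L[ℂ] X, DifferentiableOn ℂ T (Metric.ball z₀ ρ) →
      ContinuousOn T (Metric.closedBall z₀ ρ) →
      (∀ z ∈ Metric.closedBall z₀ ρ, ‖T z - 1‖ ≤ δ) →
      ∃ (P' : X →L[ℂ] X) (S : ℂ → X →L[ℂ] X), IsStarProjection P' ∧
        FiniteDimensional ℂ P'.range ∧ ‖P' - P‖ ≤ ε ∧
        DifferentiableOn ℂ S (Metric.ball z₀ ρ) ∧ ContinuousOn S (Metric.closedBall z₀ ρ) ∧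
        (∀ z ∈ Metric.closedBall z₀ ρ, ‖S z - 1‖ ≤ ε) ∧
        ∀ z ∈ Metric.closedBall z₀ ρ, elementaryFactor P n ((z - z₀) / (a - z₀)) * T z =
          S z * elementaryFactor P' n ((z - z₀) / (a - z₀)) := by
  have hρ : 0 < ρ := dist_nonneg.trans_lt ha
  set e : ℂ → ℂ := fun z => scalarFactor n ((z - z₀) / (a - z₀)) with he
  have hed : Differentiable ℂ e := differentiable_scalarFactor z₀ a n
  have hne : ∀ z ∈ Metric.sphere z₀ ρ, e z ≠ 0 := fun z hz =>
    scalarFactor_ne_zero ha₀ n fun h => (ne_of_lt ha) (h ▸ hz)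
  obtain ⟨M₁, hM₁⟩ := (isCompact_sphere z₀ ρ).exists_bound_of_continuousOn
    hed.continuous.continuousOn
  obtain ⟨M₂, hM₂⟩ := (isCompact_sphere z₀ ρ).exists_bound_of_continuousOn
    (hed.continuous.continuousOn.inv₀ hne)
  set M : ℝ := max 0 (max M₁ M₂)
  have hM0 : 0 ≤ M := le_max_left _ _
  have hMe : ∀ z ∈ Metric.sphere z₀ ρ, ‖e z‖ ≤ M := fun z hz =>
    (hM₁ z hz).trans ((le_max_left _ _).trans (le_max_right _ _))
  have hMi : ∀ z ∈ Metric.sphere z₀ ρ, ‖(e z)⁻¹‖ ≤ M := fun z hz =>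
    (hM₂ z hz).trans ((le_max_right _ _).trans (le_max_right _ _))
  set δ : ℝ := min (1 / 2) (ε / (4 * (1 + M) ^ 2))
  have hδ : 0 < δ := lt_min (by norm_num) (by positivity)
  have hδε : 4 * (1 + M) ^ 2 * δ ≤ ε := by
    have : δ ≤ ε / (4 * (1 + M) ^ 2) := min_le_right _ _
    rwa [le_div_iff₀ (by positivity), mul_comm] at this
  refine ⟨δ, hδ, fun T hTd hTc hT => ?_⟩
  have hab := Metric.ball_subset_closedBall ha
  have hballn : Metric.ball z₀ ρ ∈ 𝓝 a := Metric.isOpen_ball.mem_nhds ha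
  have hcballn : Metric.closedBall z₀ ρ ∈ 𝓝 a :=
    mem_of_superset hballn Metric.ball_subset_closedBall
  obtain ⟨P', hP', hr', hPP', hker⟩ :=
    exists_projection_near hP hr (min_le_left _ _ : δ ≤ 1 / 2) (hT a hab)
  have hPi : P * P = P := hP.isIdempotentElem
  have hPi' : P' * P' = P' := hP'.isIdempotentElem
  set g := scalarCofactor z₀ a n
  have hg : ∀ z, g z ≠ 0 := scalarCofactor_ne_zero ha₀ n
  have hgd : Differentiable ℂ fun z => (g z)⁻¹ := (differentiable_scalarCofactor z₀ a n).inv hg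
  set E : ℂ → X →L[ℂ] X := fun z => scaleOn P (e z) with hE
  have hEd : Differentiable ℂ E := (hed.smul_const P).const_add _
  -- Away from `a` this is `E * T * (scaleOn P' e)⁻¹`. The only term of the latter with a pole at
  -- `a` contains `(1 - P) * T * P'`, which vanishes at `a` by the choice of `P'`.
  set S : ℂ → X →L[ℂ] X := fun z => E z * T z * (1 - P') + P * T z * P' -
    (g z)⁻¹ • ((1 - P) * dslope T a z * P') with hS
  have hsd : DifferentiableOn ℂ (dslope T a) (Metric.ball z₀ ρ) :=
    (Complex.differentiableOn_dslope hballn).2 hTd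
  have hsc : ContinuousOn (dslope T a) (Metric.closedBall z₀ ρ) :=
    (continuousOn_dslope hcballn).2 ⟨hTc, hTd.differentiableAt hballn⟩
  have hSd : DifferentiableOn ℂ S (Metric.ball z₀ ρ) :=
    (((hEd.differentiableOn.mul hTd).mul (differentiableOn_const _)).add
      (((differentiableOn_const _).mul hTd).mul (differentiableOn_const _))).sub
      (hgd.differentiableOn.smul
        (((differentiableOn_const _).mul hsd).mul (differentiableOn_const _)))
  have hSc : ContinuousOn S (Metric.closedBall z₀ ρ) :=
    (((hEd.continuous.continuousOn.mul hTc).mul continuousOn_const).add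
      ((continuousOn_const.mul hTc).mul continuousOn_const)).sub
      (hgd.continuous.continuousOn.smul
        ((continuousOn_const.mul hsc).mul continuousOn_const))
  have hmul : ∀ z, E z * T z = S z * scaleOn P' (e z) := by
    intro z
    have h1 : (z - a) • ((1 - P) * dslope T a z * P') = (1 - P) * T z * P' := by
      rw [← smul_mul_assoc, ← mul_smul_comm, sub_smul_dslope, mul_sub, sub_mul, hker, sub_zero]
    have h2 : e z * (g z)⁻¹ = -(z - a) := by
      rw [he]
      dsimp only
      rw [scalarFactor_eq_mul_cofactor ha₀, mul_assoc, mul_inv_cancel₀ (hg z)]; ring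
    have hz1 : (1 - P') * P' = 0 := by rw [sub_mul, one_mul, hPi', sub_self]
    have hz2 : P' * (1 - P') = 0 := by rw [mul_sub, mul_one, hPi', sub_self]
    have hz3 : (1 - P') * (1 - P') = 1 - P' := by rw [mul_sub, mul_one, hz1, sub_zero]
    have hSQ : ∀ Q, S z * Q = E z * T z * ((1 - P') * Q) + P * T z * (P' * Q) -
        (g z)⁻¹ • ((1 - P) * dslope T a z * (P' * Q)) := by
      intro Q
      simp only [hS]
      rw [sub_mul, add_mul, smul_mul_assoc]
      simp only [mul_assoc]
    have h3 : S z * (1 - P') = E z * T z * (1 - P') := by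
      rw [hSQ, hz2, hz3, mul_zero, mul_zero, smul_zero, add_zero, sub_zero]
    have h4 : S z * P' = P * T z * P' - (g z)⁻¹ • ((1 - P) * dslope T a z * P') := by
      rw [hSQ, hz1, hPi', mul_zero, zero_add]
    have h5 : e z • (S z * P') = E z * T z * P' := by
      rw [h4, smul_sub, smul_smul, h2, neg_smul, h1, sub_neg_eq_add, hE]
      simp only [scaleOn, add_mul, smul_mul_assoc]
      rw [add_comm]
    rw [scaleOn, mul_add, h3, mul_smul_comm, h5, ← mul_add, sub_add_cancel, mul_one]
  have hbd : ∀ z ∈ Metric.sphere z₀ ρ, ‖S z - 1‖ ≤ ε := by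
    intro z hz
    have hzb : z ∈ Metric.closedBall z₀ ρ := Metric.sphere_subset_closedBall hz
    have h1 := scaleOn_mul_inv hP'.isIdempotentElem (hne z hz)
    have h2 : S z - 1 = (E z * (T z - 1) + (e z - 1) • (P - P')) * scaleOn P' (e z)⁻¹ := by
      have h3 : E z * (T z - 1) + (e z - 1) • (P - P') = (S z - 1) * scaleOn P' (e z) := by
        rw [mul_sub, hmul, sub_mul (S z), mul_one, one_mul, hE]
        simp only [scaleOn, sub_smul, smul_sub, one_smul]
        abel
      rw [h3, mul_assoc, h1, mul_one]
    have h4 : ‖E z‖ ≤ 1 + M := (norm_scaleOn_le hP _).trans (by linarith [hMe z hz])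
    have h5 : ‖scaleOn P' (e z)⁻¹‖ ≤ 1 + M :=
      (norm_scaleOn_le hP' _).trans (by linarith [hMi z hz])
    have h6 : ‖e z - 1‖ ≤ 1 + M := (norm_sub_le _ _).trans (by
      rw [norm_one]; linarith [hMe z hz])
    have h7 : ‖P - P'‖ ≤ 3 * δ := by rw [norm_sub_rev]; exact hPP'
    have h8 := hT z hzb
    rw [h2]
    calc _ ≤ (‖E z‖ * ‖T z - 1‖ + ‖e z - 1‖ * ‖P - P'‖) * ‖scaleOn P' (e z)⁻¹‖ := by
          refine (norm_mul_le _ _).trans ?_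
          gcongr
          refine (norm_add_le _ _).trans ?_
          gcongr
          · exact norm_mul_le _ _
          · exact norm_smul_le _ _
      _ ≤ ((1 + M) * δ + (1 + M) * (3 * δ)) * (1 + M) := by gcongr
      _ = 4 * (1 + M) ^ 2 * δ := by ring
      _ ≤ ε := hδε
  refine ⟨P', S, hP', hr', hPP'.trans ?_, hSd, hSc, fun z hz => ?_, fun z hz => ?_⟩
  · have : 3 * δ ≤ 4 * (1 + M) ^ 2 * δ := by
      gcongr; nlinarith
    linarith
  · have hcl : closure (Metric.ball z₀ ρ) = Metric.closedBall z₀ ρ := closure_ball z₀ hρ.ne'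
    refine Complex.norm_le_of_forall_mem_frontier_norm_le (f := fun z => S z - 1)
      (U := Metric.ball z₀ ρ) Metric.isBounded_ball
      ⟨hSd.sub (differentiableOn_const _), ?_⟩ ?_ (by rwa [hcl])
    · rw [hcl]; exact hSc.sub continuousOn_const
    · rw [frontier_ball z₀ hρ.ne']; exact hbd
  · rw [elementaryFactor_eq hP.isIdempotentElem, elementaryFactor_eq hP'.isIdempotentElem]
    exact hmul z

/-- A function close to `1` can be moved to the left of a finite product of elementary factors, at
the expense of a small change of the projections. -/
lemma exists_partialProduct_mul_eq {a : ℕ → ℂ} {P : ℕ → X →L[ℂ] X}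
    (hP : ∀ i, IsStarProjection (P i)) (hr : ∀ i, FiniteDimensional ℂ (P i).range) (n : ℕ)
    (ha : ∀ i < n, a i ∈ Metric.ball z₀ ρ) (ha₀ : ∀ i < n, a i ≠ z₀) :
    ∀ ε > 0, ∃ δ > 0, ∀ T : ℂ → X →L[ℂ] X, DifferentiableOn ℂ T (Metric.ball z₀ ρ) →
      ContinuousOn T (Metric.closedBall z₀ ρ) →
      (∀ z ∈ Metric.closedBall z₀ ρ, ‖T z - 1‖ ≤ δ) →
      ∃ (P' : ℕ → X →L[ℂ] X) (S : ℂ → X →L[ℂ] X), (∀ i, IsStarProjection (P' i)) ∧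
        (∀ i, FiniteDimensional ℂ (P' i).range) ∧ (∀ i < n, ‖P' i - P i‖ ≤ ε) ∧
        DifferentiableOn ℂ S (Metric.ball z₀ ρ) ∧ ContinuousOn S (Metric.closedBall z₀ ρ) ∧
        (∀ z ∈ Metric.closedBall z₀ ρ, ‖S z - 1‖ ≤ ε) ∧
        ∀ z ∈ Metric.closedBall z₀ ρ,
          partialProduct z₀ a P n z * T z = S z * partialProduct z₀ a P' n z := by
  induction n with
  | zero =>
    intro ε hε
    refine ⟨ε, hε, fun T hTd hTc hT => ⟨P, T, hP, hr, fun i hi => absurd hi (by simp), hTd, hTc,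
      hT, fun z _ => ?_⟩⟩
    change 1 * T z = T z * 1
    rw [one_mul, mul_one]
  | succ n ih =>
    intro ε hε
    obtain ⟨δ₁, hδ₁, h₁⟩ := ih (fun i hi => ha i (hi.trans n.lt_succ_self))
      (fun i hi => ha₀ i (hi.trans n.lt_succ_self)) ε hε
    obtain ⟨δ, hδ, h₂⟩ := exists_elementaryFactor_mul_eq (ha n n.lt_succ_self)
      (ha₀ n n.lt_succ_self) (hP n) (hr n) (n + 1) (lt_min hε hδ₁)
    refine ⟨δ, hδ, fun T hTd hTc hT => ?_⟩
    obtain ⟨Q, S₁, hQ, hQr, hQP, hS₁d, hS₁c, hS₁, hmul₁⟩ := h₂ T hTd hTc hT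
    obtain ⟨P', S, hP', hr', hPP', hSd, hSc, hS, hmul⟩ := h₁ S₁ hS₁d hS₁c
      fun z hz => (hS₁ z hz).trans (min_le_right _ _)
    refine ⟨Function.update P' n Q, S, fun i => ?_, fun i => ?_, fun i hi => ?_, hSd, hSc, hS,
      fun z hz => ?_⟩
    · rcases eq_or_ne i n with rfl | hin
      · rwa [Function.update_self]
      · rw [Function.update_of_ne hin]; exact hP' i
    · rcases eq_or_ne i n with rfl | hin
      · rwa [Function.update_self]
      · rw [Function.update_of_ne hin]; exact hr' i
    · rcases eq_or_ne i n with rfl | hin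
      · rw [Function.update_self]; exact hQP.trans (min_le_left _ _)
      · rw [Function.update_of_ne hin]; exact hPP' i (by omega)
    · rw [partialProduct, partialProduct, Function.update_self,
        partialProduct_congr (P := Function.update P' n Q) (P' := P') (fun i _ => rfl)
          (fun i hi => Function.update_of_ne hi.ne _ _), mul_assoc, hmul₁ z hz, ← mul_assoc,
        hmul z hz, mul_assoc]

end Perturbation

/-! ### Zeros split off on the right -/

section RightFactorization

variable {X : Type*} [NormedAddCommGroup X] [InnerProductSpace ℂ X] [CompleteSpace X]

/-- All singularities in a finite set can be split off on the right; the degrees of the factors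
start at `N + 1`. -/
lemma exists_block_quotient {z₀ : ℂ} {Z : Finset ℂ} (hZ : ∀ b ∈ Z, b ≠ z₀) (N m : ℕ) :
    ∀ {A : ℂ → X →L[ℂ] X} {f : ℂ → ℕ}, Differentiable ℂ A → (∀ z, (A z).IsFredholm) →
      (∀ b, HasInverseOrder A b (f b)) → ∑ b ∈ Z, f b = m →
      ∃ (a : ℕ → ℂ) (P : ℕ → X →L[ℂ] X) (A' : ℂ → X →L[ℂ] X), (∀ i, IsStarProjection (P i)) ∧
        (∀ i, FiniteDimensional ℂ (P i).range) ∧ (∀ i < m, a i ∈ Z) ∧ Differentiable ℂ A' ∧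
        (∀ z, A z = A' z * orderedProd
          (fun i => elementaryFactor (P i) (N + i + 1) ((z - z₀) / (a i - z₀))) m) ∧
        ∀ b, f b = 0 ∨ b ∈ Z → IsUnit (A' b) := by
  induction m with
  | zero =>
    intro A f hA hF hf hsum
    have h0 : ∀ b ∈ Z, f b = 0 := Finset.sum_eq_zero_iff.1 hsum
    refine ⟨fun _ => z₀, fun _ => 0, A, fun _ => .zero _, fun _ => ?_, fun i hi => absurd hi
      (by simp), hA, fun z => by simp, fun b hb => ?_⟩
    · have : (0 : X →L[ℂ] X).range = ⊥ := LinearMap.range_zero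
      rw [this]; infer_instance
    · have hb0 : f b = 0 := hb.elim id (h0 b)
      exact HasInverseOrder.isUnit (hb0 ▸ hf b) (hA b).continuousAt
  | succ m ih =>
    intro A f hA hF hf hsum
    obtain ⟨x, hx, hfx⟩ : ∃ x ∈ Z, f x ≠ 0 := by
      by_contra! h
      rw [Finset.sum_eq_zero h] at hsum
      omega
    obtain ⟨Q, A₁, hQ, hQr, hA₁, hF₁, hmul, hord⟩ :=
      exists_right_elementaryFactor hA hF (hZ x hx) (N + m + 1)
    have hsum₁ : ∑ b ∈ Z, (if b = x then f b - 1 else f b) = m := by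
      have h1 : f x + ∑ b ∈ Z.erase x, f b = ∑ b ∈ Z, f b := Finset.add_sum_erase Z f hx
      have h2 : ∑ b ∈ Z.erase x, (if b = x then f b - 1 else f b) = ∑ b ∈ Z.erase x, f b :=
        Finset.sum_congr rfl fun b hb => if_neg (Finset.ne_of_mem_erase hb)
      rw [← Finset.add_sum_erase Z _ hx, if_pos rfl, h2]
      omega
    obtain ⟨a, P, A', hP, hr, ha, hA', hmul', hu⟩ :=
      ih hA₁ hF₁ (fun b => hord b _ (hf b)) hsum₁
    refine ⟨Function.update a m x, Function.update P m Q, A', fun i => ?_, fun i => ?_,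
      fun i hi => ?_, hA', fun z => ?_, fun b hb => hu b ?_⟩
    · rcases eq_or_ne i m with rfl | him
      · rwa [Function.update_self]
      · rw [Function.update_of_ne him]; exact hP i
    · rcases eq_or_ne i m with rfl | him
      · rwa [Function.update_self]
      · rw [Function.update_of_ne him]; exact hr i
    · rcases eq_or_ne i m with rfl | him
      · rwa [Function.update_self]
      · rw [Function.update_of_ne him]; exact ha i (by omega)
    · rw [orderedProd_succ, Function.update_self, Function.update_self, ← mul_assoc, hmul, hmul']
      congr 2
      refine orderedProd_congr fun i hi => ?_
      rw [Function.update_of_ne hi.ne, Function.update_of_ne hi.ne]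
    · rcases hb with hb | hb
      · left
        simp [hb]
      · exact Or.inr hb

/-- A finite stage of the construction: a finite product of elementary factors with zeros in the
disc of radius `ρ` which divides `A` on the right, with a quotient invertible on that disc. -/
structure IsStage (A : ℂ → X →L[ℂ] X) (z₀ : ℂ) (ρ : ℝ) (n : ℕ) (a : ℕ → ℂ) (P : ℕ → X →L[ℂ] X)
    (F : ℂ → X →L[ℂ] X) : Prop where
  isStarProjection : ∀ i, IsStarProjection (P i)
  finiteDimensional : ∀ i, FiniteDimensional ℂ (P i).range
  mem_ball : ∀ i < n, a i ∈ Metric.ball z₀ ρ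
  ne_center : ∀ i < n, a i ≠ z₀
  differentiable : Differentiable ℂ F
  eq_mul : ∀ z, A z = F z * partialProduct z₀ a P n z
  isUnit : ∀ z ∈ Metric.closedBall z₀ ρ, IsUnit (F z)

/-- Passage to a larger disc. Splitting off the new zeros on the right produces a block `T` of
factors, and the old product `Q` has to be moved past `T⁻¹`. This is possible with a small change of
`Q`, because `T` is close to `1` on the old disc when the degrees of its factors are large; large
degrees are available by inserting trivial factors in front of the block. -/
lemma IsStage.exists_next {A : ℂ → X →L[ℂ] X} (hA : Differentiable ℂ A)
    (hF : ∀ z, (A z).IsFredholm) {z₀ : ℂ} {f : ℂ → ℕ} (hf : ∀ b, HasInverseOrder A b (f b))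
    (hffin : ∀ r, {b ∈ Metric.closedBall z₀ r | f b ≠ 0}.Finite) {ρ ρ' : ℝ} (hρ : 0 ≤ ρ)
    (hρρ' : ρ < ρ') (hsphere : ∀ b, dist b z₀ = ρ' → f b = 0) {n : ℕ} {a : ℕ → ℂ}
    {P : ℕ → X →L[ℂ] X} {F : ℂ → X →L[ℂ] X} (h : IsStage A z₀ ρ n a P F) {ε : ℝ} (hε : 0 < ε) :
    ∃ (n' : ℕ) (a' : ℕ → ℂ) (P' : ℕ → X →L[ℂ] X) (F' S : ℂ → X →L[ℂ] X),
      IsStage A z₀ ρ' n' a' P' F' ∧ n < n' ∧ (∀ i < n, a' i = a i) ∧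
      (∀ i, n ≤ i → i < n' → ρ < dist (a' i) z₀) ∧ (∀ i < n, ‖P' i - P i‖ ≤ ε) ∧
      DifferentiableOn ℂ S (Metric.ball z₀ ρ) ∧
      ∀ z ∈ Metric.closedBall z₀ ρ, ‖S z - 1‖ ≤ ε ∧ F' z = F z * S z := by
  classical
  obtain ⟨δ, hδ, hpert⟩ := exists_partialProduct_mul_eq h.isStarProjection h.finiteDimensional n
    h.mem_ball h.ne_center (min ε (1 / 2)) (lt_min hε (by norm_num))
  set Z : Finset ℂ := (hffin ρ').toFinset.filter fun b => ρ < dist b z₀ with hZdef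
  have hZmem : ∀ b, b ∈ Z ↔ (dist b z₀ ≤ ρ' ∧ f b ≠ 0) ∧ ρ < dist b z₀ := fun b => by
    rw [hZdef, Finset.mem_filter, Set.Finite.mem_toFinset]; rfl
  have hZ₀ : ∀ b ∈ Z, b ≠ z₀ := by
    rintro b hb rfl
    have := ((hZmem b).1 hb).2
    rw [dist_self] at this
    linarith
  have hZlt : ∀ b ∈ Z, dist b z₀ < ρ' := fun b hb =>
    lt_of_le_of_ne ((hZmem b).1 hb).1.1 fun heq => ((hZmem b).1 hb).1.2 (hsphere b heq)
  -- The trivial factors are placed at a point `p` of the open annulus.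
  set p : ℂ := z₀ + ((ρ + ρ') / 2 : ℝ)
  have hp : dist p z₀ = (ρ + ρ') / 2 := by
    rw [dist_eq_norm, add_sub_cancel_left, Complex.norm_real, Real.norm_of_nonneg (by linarith)]
  have hp₀ : p ≠ z₀ := fun hp' => by
    rw [hp', dist_self] at hp
    linarith
  obtain ⟨b₁, hb₁, hmin⟩ := (insert p Z).exists_min_image (fun b => dist b z₀)
    (Finset.insert_nonempty p Z)
  set ρ₁ := dist b₁ z₀
  have hρ₁ : ρ < ρ₁ := by
    rcases Finset.mem_insert.1 hb₁ with hb | hb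
    · change ρ < dist b₁ z₀
      rw [hb, hp]; linarith
    · exact ((hZmem b₁).1 hb).2
  have hρ₁0 : 0 < ρ₁ := hρ.trans_lt hρ₁
  set q := ρ / ρ₁
  have hq0 : 0 ≤ q := by positivity
  have hq1 : q < 1 := (div_lt_one hρ₁0).2 hρ₁
  have hw : ∀ b ∈ Z, ∀ z ∈ Metric.closedBall z₀ ρ, ‖(z - z₀) / (b - z₀)‖ ≤ q := by
    intro b hb z hz
    rw [norm_div, ← dist_eq_norm, ← dist_eq_norm]
    exact div_le_div₀ hρ hz hρ₁0 (hmin b (Finset.mem_insert_of_mem hb))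
  obtain ⟨C, hC0, hC⟩ := exists_norm_scalarFactor_sub_one_le hq1
  set m := ∑ b ∈ Z, f b with hm
  set η : ℝ := min (1 / 2) (δ / 2)
  have hη : 0 < η := lt_min (by norm_num) (by positivity)
  obtain ⟨d, hd, hd1⟩ : ∃ d : ℕ,
      ‖(1 : X →L[ℂ] X)‖ * Real.exp (m * (C * q ^ d)) * (m * (C * q ^ d)) ≤ η ∧ 1 ≤ d := by
    have h1 : Tendsto (fun d : ℕ => (m : ℝ) * (C * q ^ d)) atTop (𝓝 0) := by
      have := ((tendsto_pow_atTop_nhds_zero_of_lt_one hq0 hq1).const_mul C).const_mul (m : ℝ)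
      simpa using this
    have h2 : Tendsto (fun d : ℕ => ‖(1 : X →L[ℂ] X)‖ * Real.exp (m * (C * q ^ d)) *
        (m * (C * q ^ d))) atTop (𝓝 0) := by
      have := (((Real.continuous_exp.tendsto 0).comp h1).const_mul ‖(1 : X →L[ℂ] X)‖).mul h1
      simpa using this
    exact ((h2.eventually_le_const hη).and (eventually_ge_atTop 1)).exists
  obtain ⟨aB, PB, A', hPB, hrB, haB, hA', hmulB, huB⟩ :=
    exists_block_quotient hZ₀ (n + d) m hA hF hf hm.symm
  set T : ℂ → X →L[ℂ] X := fun z => orderedProd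
    (fun i => elementaryFactor (PB i) (n + d + i + 1) ((z - z₀) / (aB i - z₀))) m
  have hTd : Differentiable ℂ T := differentiable_orderedProd fun i _ =>
    differentiable_elementaryFactor (hPB i).isIdempotentElem z₀ (aB i) _
  have hT : ∀ z ∈ Metric.closedBall z₀ ρ, ‖T z - 1‖ ≤ η := by
    intro z hz
    refine (norm_orderedProd_sub_one_le (c := fun _ => C * q ^ d) (fun i hi => ?_) ?_).trans hd
    · refine (norm_elementaryFactor_sub_one_le (hPB i) _ _).trans
        ((hC _ _ (hw _ (haB i hi) z hz)).trans ?_)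
      gcongr ?_ * ?_
      exact pow_le_pow_of_le_one hq0 hq1.le (by omega)
    · simp
  have hη2 : η ≤ 1 / 2 := min_le_left _ _
  have hTu : ∀ z ∈ Metric.closedBall z₀ ρ, IsUnit (T z) := fun z hz =>
    isUnit_of_norm_sub_one_lt_one ((hT z hz).trans_lt (by linarith))
  have hTinv : ∀ z ∈ Metric.closedBall z₀ ρ,
      DifferentiableAt ℂ (fun z => Ring.inverse (T z)) z := fun z hz =>
    (analyticAt_inverse_comp (hTd.analyticAt z) (hTu z hz)).differentiableAt
  obtain ⟨P'', S, hP'', hr'', hPP'', hSd, -, hS, hQS⟩ := hpert (fun z => Ring.inverse (T z))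
    (fun z hz => (hTinv z (Metric.ball_subset_closedBall hz)).differentiableWithinAt)
    (fun z hz => (hTinv z hz).continuousAt.continuousWithinAt)
    fun z hz => (norm_inverse_sub_one_le hη2 (hT z hz)).trans (by
      have : η ≤ δ / 2 := min_le_right _ _
      linarith)
  set Q' : ℂ → X →L[ℂ] X := partialProduct z₀ a P'' n
  have hQ'd : Differentiable ℂ Q' := differentiable_partialProduct hP'' n
  have hQ'u : ∀ z, z ∉ Metric.ball z₀ ρ → IsUnit (Q' z) := fun z hz =>
    isUnit_partialProduct hP'' h.ne_center fun i hi hzi => hz (hzi ▸ h.mem_ball i hi)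
  -- Both expressions equal `A' * Q'⁻¹` where `Q'` is invertible; the first one is holomorphic on
  -- the open disc, the second one outside it, since the zeros of `Q'` lie in the open disc.
  set F' : ℂ → X →L[ℂ] X := fun z =>
    if z ∈ Metric.closedBall z₀ ρ then F z * S z else A' z * Ring.inverse (Q' z) with hF'
  have hF'1 : ∀ z ∈ Metric.closedBall z₀ ρ, F' z = F z * S z := fun z hz => if_pos hz
  have hF'2 : ∀ z, A' z = F' z * Q' z := by
    intro z
    by_cases hz : z ∈ Metric.closedBall z₀ ρ
    · have h1 : A' z = A z * Ring.inverse (T z) := by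
        rw [hmulB z, mul_assoc, Ring.mul_inverse_cancel _ (hTu z hz), mul_one]
      rw [hF'1 z hz, h1, h.eq_mul z, mul_assoc, hQS z hz, mul_assoc]
    · have hz' : z ∉ Metric.ball z₀ ρ := fun h' => hz (Metric.ball_subset_closedBall h')
      rw [hF']
      dsimp only
      rw [if_neg hz, mul_assoc, Ring.inverse_mul_cancel _ (hQ'u z hz'), mul_one]
  have hF'd : Differentiable ℂ F' := by
    intro z
    by_cases hz : z ∈ Metric.ball z₀ ρ
    · have hzn := Metric.isOpen_ball.mem_nhds hz
      refine ((h.differentiable z).mul (hSd.differentiableAt hzn)).congr_of_eventuallyEq ?_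
      filter_upwards [hzn] with y hy
      exact hF'1 y (Metric.ball_subset_closedBall hy)
    · have h1 := analyticAt_inverse_comp (hQ'd.analyticAt z) (hQ'u z hz)
      refine ((hA' z).mul h1.differentiableAt).congr_of_eventuallyEq ?_
      filter_upwards [eventually_isUnit_of_isUnit (hQ'd z).continuousAt (hQ'u z hz)] with y hy
      change F' y = A' y * Ring.inverse (Q' y)
      rw [hF'2 y, mul_assoc, Ring.mul_inverse_cancel _ hy, mul_one]
  set a' : ℕ → ℂ := fun i => if i < n then a i else if i < n + d then p else aB (i - (n + d))
    with ha'
  set P' : ℕ → X →L[ℂ] X := fun i =>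
    if i < n then P'' i else if i < n + d then 0 else PB (i - (n + d)) with hP'
  have ha'1 : ∀ i < n, a' i = a i := fun i hi => if_pos hi
  have hP'1 : ∀ i < n, P' i = P'' i := fun i hi => if_pos hi
  have ha'2 : ∀ i, n ≤ i → i < n + d + m → a' i = p ∨ a' i ∈ Z := by
    intro i hi hi'
    simp only [ha']
    rw [if_neg (not_lt.2 hi)]
    split_ifs with hid
    · exact Or.inl rfl
    · exact Or.inr (haB _ (by omega))
  have hprod : ∀ z, partialProduct z₀ a' P' (n + d + m) z = Q' z * T z := by
    intro z
    rw [partialProduct_eq_orderedProd, orderedProd_add, orderedProd_add,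
      ← partialProduct_eq_orderedProd, partialProduct_congr ha'1 hP'1]
    have h1 : orderedProd (fun k => elementaryFactor (P' (n + k)) (n + k + 1)
        ((z - z₀) / (a' (n + k) - z₀))) d = 1 := by
      refine orderedProd_eq_one fun k hk => ?_
      have : P' (n + k) = 0 := by
        simp only [hP']
        rw [if_neg (by omega), if_pos (by omega)]
      rw [this, elementaryFactor_zero]
    rw [h1, mul_one]
    congr 1
    refine orderedProd_congr fun k _ => ?_
    have h2 : P' (n + d + k) = PB k := by
      simp only [hP']
      rw [if_neg (by omega), if_neg (by omega), Nat.add_sub_cancel_left]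
    have h3 : a' (n + d + k) = aB k := by
      simp only [ha']
      rw [if_neg (by omega), if_neg (by omega), Nat.add_sub_cancel_left]
    rw [h2, h3]
  refine ⟨n + d + m, a', P', F', S, ⟨fun i => ?_, fun i => ?_, fun i hi => ?_, fun i hi => ?_,
    hF'd, fun z => ?_, fun z hz => ?_⟩, by omega, ha'1, fun i hi hi' => ?_, fun i hi => ?_, hSd,
    fun z hz => ⟨(hS z hz).trans (min_le_left _ _), hF'1 z hz⟩⟩
  · simp only [hP']
    split_ifs
    exacts [hP'' i, .zero _, hPB _]
  · have hP'i : P' i = P'' i ∨ P' i = 0 ∨ P' i = PB (i - (n + d)) := by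
      simp only [hP']
      split_ifs <;> simp
    rcases hP'i with h1 | h1 | h1
    · rw [h1]; exact hr'' i
    · have : (0 : X →L[ℂ] X).range = ⊥ := LinearMap.range_zero
      rw [h1, this]; infer_instance
    · rw [h1]; exact hrB _
  · by_cases hin : i < n
    · rw [ha'1 i hin]
      exact Metric.ball_subset_ball hρρ'.le (h.mem_ball i hin)
    · rw [Metric.mem_ball]
      rcases ha'2 i (not_lt.1 hin) hi with h1 | h1
      · rw [h1, hp]; linarith
      · exact hZlt _ h1
  · by_cases hin : i < n
    · rw [ha'1 i hin]; exact h.ne_center i hin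
    · rcases ha'2 i (not_lt.1 hin) hi with h1 | h1
      · rw [h1]; exact hp₀
      · exact hZ₀ _ h1
  · rw [hprod, ← mul_assoc, ← hF'2, ← hmulB]
  · by_cases hzρ : z ∈ Metric.closedBall z₀ ρ
    · rw [hF'1 z hzρ]
      refine (h.isUnit z hzρ).mul (isUnit_of_norm_sub_one_lt_one ((hS z hzρ).trans_lt ?_))
      exact (min_le_right _ _).trans_lt (by norm_num)
    · have hz' : z ∉ Metric.ball z₀ ρ := fun h' => hzρ (Metric.ball_subset_closedBall h')
      have h1 : IsUnit (A' z) := by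
        refine huB z ?_
        by_cases hfz : f z = 0
        · exact Or.inl hfz
        · exact Or.inr ((hZmem z).2 ⟨⟨hz, hfz⟩, not_le.1 hzρ⟩)
      have h2 : F' z = A' z * Ring.inverse (Q' z) := if_neg hzρ
      rw [h2]
      exact h1.mul (hQ'u z hz').ringInverse
  · rcases ha'2 i hi hi' with h1 | h1
    · rw [h1, hp]; linarith
    · exact ((hZmem _).1 h1).2
  · rw [hP'1 i hi]
    exact (hPP'' i hi).trans (min_le_left _ _)

/-- An exhaustion of the plane by discs whose boundary circles avoid the singularities. -/
lemma exists_radii {z₀ : ℂ} {f : ℂ → ℕ} (hf : ∀ r, {b ∈ Metric.closedBall z₀ r | f b ≠ 0}.Finite)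
    (hf₀ : f z₀ = 0) : ∃ r : ℕ → ℝ, r 0 = 0 ∧ StrictMono r ∧ Tendsto r atTop atTop ∧
      ∀ k b, dist b z₀ = r k → f b = 0 := by
  have hcount : {b | f b ≠ 0}.Countable := by
    refine (Set.countable_iUnion fun n : ℕ => (hf n).countable).mono fun b hb => ?_
    obtain ⟨n, hn⟩ := exists_nat_ge (dist b z₀)
    exact Set.mem_iUnion.2 ⟨n, hn, hb⟩
  have hD : Dense (((fun b => dist b z₀) '' {b | f b ≠ 0})ᶜ : Set ℝ) :=
    (hcount.image _).dense_compl ℝ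
  have hex : ∀ n : ℕ, ∃ s ∈ Set.Ioo (n : ℝ) (n + 1), ∀ b, dist b z₀ = s → f b = 0 := by
    intro n
    obtain ⟨s, hs, hsD⟩ := hD.exists_mem_open isOpen_Ioo
      (Set.nonempty_Ioo.2 (lt_add_one (n : ℝ)))
    refine ⟨s, hsD, fun b hb => ?_⟩
    by_contra hne
    exact hs ⟨b, hne, hb⟩
  choose s hs hsf using hex
  refine ⟨fun k => Nat.casesOn k 0 s, rfl, strictMono_nat_of_lt_succ fun k => ?_, ?_,
    fun k b hb => ?_⟩
  · cases k with
    | zero => simpa using (hs 0).1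
    | succ k =>
      have h1 := (hs k).2
      have h2 := (hs (k + 1)).1
      push_cast at h2
      exact h1.trans h2
  · rw [← tendsto_add_atTop_iff_nat 1]
    exact tendsto_atTop_mono (fun k => (hs k).1.le) tendsto_natCast_atTop_atTop
  · cases k with
    | zero =>
      have : b = z₀ := dist_eq_zero.1 hb
      rw [this, hf₀]
    | succ k => exact hsf k b hb

lemma isStarProjection_of_tendsto {p : ℕ → X →L[ℂ] X} {P : X →L[ℂ] X}
    (hp : ∀ k, IsStarProjection (p k)) (h : Tendsto p atTop (𝓝 P)) : IsStarProjection P where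
  isIdempotentElem := tendsto_nhds_unique (h.mul h) (h.congr fun k => (hp k).isIdempotentElem.symm)
  isSelfAdjoint := tendsto_nhds_unique
    ((continuous_star.tendsto P).comp h) (h.congr fun k => (hp k).isSelfAdjoint.symm)

/-- A projection near one of finite rank has finite rank: the latter is injective on the range of
the former. -/
lemma finiteDimensional_range_of_norm_sub_lt_one {P Q : X →L[ℂ] X} (hP : IsStarProjection P)
    (hQ : FiniteDimensional ℂ Q.range) (h : ‖P - Q‖ < 1) : FiniteDimensional ℂ P.range := by
  let φ : P.range →ₗ[ℂ] Q.range := (Q.toLinearMap.rangeRestrict).domRestrict P.range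
  refine FiniteDimensional.of_injective φ ((injective_iff_map_eq_zero φ).2 ?_)
  rintro ⟨x, y, hy⟩ hx
  have h1 : Q x = 0 := congrArg Subtype.val hx
  have h2 : P x = x := by
    rw [← hy]
    exact congrArg (fun T : X →L[ℂ] X => T y) hP.isIdempotentElem
  have h3 : ‖x‖ ≤ ‖P - Q‖ * ‖x‖ := by
    have := (P - Q).le_opNorm x
    rwa [sub_apply, h1, h2, sub_zero] at this
  have h4 : ‖x‖ = 0 := by nlinarith [norm_nonneg x]
  exact Subtype.ext (norm_eq_zero.1 h4)

/-- The stages converge: the projections and the quotients form Cauchy sequences. -/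
theorem exists_eq_mul_weierstrassProduct {A : ℂ → X →L[ℂ] X} (hA : Differentiable ℂ A)
    (hF : ∀ z, (A z).IsFredholm) {z₀ : ℂ} (hz₀ : IsUnit (A z₀)) :
    ∃ F Q : ℂ → X →L[ℂ] X, IsWeierstrassProduct z₀ Q ∧ Differentiable ℂ Q ∧
      Differentiable ℂ F ∧ (∀ z, IsUnit (F z)) ∧ ∀ z, A z = F z * Q z := by
  obtain ⟨f, hf, hfunit, hffin⟩ := exists_divisor hA hF hz₀
  obtain ⟨r, hr0, hrmono, hrtop, hrf⟩ := exists_radii hffin (hfunit z₀ hz₀)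
  have hrnonneg : ∀ k, 0 ≤ r k := fun k => hr0 ▸ hrmono.monotone (Nat.zero_le k)
  let St (k : ℕ) := {s : ℕ × (ℕ → ℂ) × (ℕ → X →L[ℂ] X) × (ℂ → X →L[ℂ] X) //
    IsStage A z₀ (r k) s.1 s.2.1 s.2.2.1 s.2.2.2}
  have hstep : ∀ (k : ℕ) (s : St k), ∃ (s' : St (k + 1)) (S : ℂ → X →L[ℂ] X),
      s.1.1 < s'.1.1 ∧ (∀ i < s.1.1, s'.1.2.1 i = s.1.2.1 i) ∧
      (∀ i, s.1.1 ≤ i → i < s'.1.1 → r k < dist (s'.1.2.1 i) z₀) ∧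
      (∀ i < s.1.1, ‖s'.1.2.2.1 i - s.1.2.2.1 i‖ ≤ (1 / 2) ^ (k + 1)) ∧
      DifferentiableOn ℂ S (Metric.ball z₀ (r k)) ∧
      ∀ z ∈ Metric.closedBall z₀ (r k), ‖S z - 1‖ ≤ (1 / 2) ^ (k + 1) ∧
        s'.1.2.2.2 z = s.1.2.2.2 z * S z := by
    intro k s
    obtain ⟨n', a', P', F', S, h1, h2⟩ := s.2.exists_next hA hF hf hffin (hrnonneg k)
      (hrmono k.lt_succ_self) (hrf (k + 1)) (show (0 : ℝ) < (1 / 2) ^ (k + 1) by positivity)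
    exact ⟨⟨(n', a', P', F'), h1⟩, S, h2⟩
  choose next Sf hnlt haeq hadist hPnear hSd hS using hstep
  have h0 : IsStage A z₀ (r 0) 0 (fun _ => z₀) (fun _ => 0) A := by
    refine ⟨fun _ => .zero _, fun _ => ?_, fun i hi => absurd hi (by simp), fun i hi => absurd hi
      (by simp), hA, fun z => (mul_one _).symm, fun z hz => ?_⟩
    · have : (0 : X →L[ℂ] X).range = ⊥ := LinearMap.range_zero
      rw [this]; infer_instance
    · rw [hr0, Metric.closedBall_zero, Set.mem_singleton_iff] at hz
      rwa [hz]
  let st : ∀ k, St k := fun k =>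
    Nat.rec ⟨(0, fun _ => z₀, fun _ => 0, A), h0⟩ (fun k s => next k s) k
  let n : ℕ → ℕ := fun k => (st k).1.1
  let a : ℕ → ℕ → ℂ := fun k => (st k).1.2.1
  let P : ℕ → ℕ → X →L[ℂ] X := fun k => (st k).1.2.2.1
  let F : ℕ → ℂ → X →L[ℂ] X := fun k => (st k).1.2.2.2
  let S : ℕ → ℂ → X →L[ℂ] X := fun k => Sf k (st k)
  have hst : ∀ k, IsStage A z₀ (r k) (n k) (a k) (P k) (F k) := fun k => (st k).2
  have hn : StrictMono n := strictMono_nat_of_lt_succ fun k => hnlt k (st k)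
  have ha_succ : ∀ k, ∀ i < n k, a (k + 1) i = a k i := fun k => haeq k (st k)
  have ha_dist : ∀ k i, n k ≤ i → i < n (k + 1) → r k < dist (a (k + 1) i) z₀ :=
    fun k => hadist k (st k)
  have hP_succ : ∀ k, ∀ i < n k, ‖P (k + 1) i - P k i‖ ≤ (1 / 2) ^ (k + 1) :=
    fun k => hPnear k (st k)
  have hS_diff : ∀ k, DifferentiableOn ℂ (S k) (Metric.ball z₀ (r k)) := fun k => hSd k (st k)
  have hF_succ : ∀ k, ∀ z ∈ Metric.closedBall z₀ (r k), ‖S k z - 1‖ ≤ (1 / 2) ^ (k + 1) ∧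
      F (k + 1) z = F k z * S k z := fun k => hS k (st k)
  have hlt : ∀ i, i < n (i + 1) := fun i => (Nat.lt_succ_self i).trans_le (hn.id_le _)
  -- The zeros stabilise.
  have ha_le : ∀ k l, k ≤ l → ∀ i < n k, a l i = a k i := by
    intro k l hkl
    induction l, hkl using Nat.le_induction with
    | base => exact fun _ _ => rfl
    | succ l hkl ih =>
      intro i hi
      rw [ha_succ l i (hi.trans_le (hn.monotone hkl)), ih i hi]
  let α : ℕ → ℂ := fun i => a (i + 1) i
  have hα : ∀ k, ∀ i < n k, a k i = α i := by
    intro k i hi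
    rcases le_total k (i + 1) with h | h
    · exact (ha_le k (i + 1) h i hi).symm
    · exact ha_le (i + 1) k h i (hlt i)
  have hα₀ : ∀ i, α i ≠ z₀ := fun i => (hst (i + 1)).ne_center i (hlt i)
  have hαdist : ∀ k l i, n k ≤ i → i < n l → r k < dist (a l i) z₀ := by
    intro k l i hki hil
    induction l with
    | zero => exact absurd hil (by simp [n, st])
    | succ l ih =>
      rcases lt_or_ge i (n l) with h | h
      · rw [ha_succ l i h]; exact ih h
      · have hkl : k < l + 1 := hn.lt_iff_lt.1 (hki.trans_lt hil)
        exact (hrmono.monotone (Nat.lt_succ_iff.1 hkl)).trans_lt (ha_dist l i h hil)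
  have hαtop : Tendsto (fun i => ‖α i‖) atTop atTop := by
    rw [tendsto_atTop]
    intro R
    obtain ⟨k, hk⟩ := (hrtop.eventually_ge_atTop (R + ‖z₀‖)).exists
    filter_upwards [eventually_ge_atTop (n k)] with i hi
    have h1 := hαdist k (i + 1) i hi (hlt i)
    rw [dist_eq_norm] at h1
    have h2 := norm_sub_le (a (i + 1) i) z₀
    change R ≤ ‖a (i + 1) i‖
    linarith
  -- The projections converge.
  have hPlim : ∀ i, ∃ p, Tendsto (fun k => P k i) atTop (𝓝 p) := by
    intro i
    have hc : CauchySeq fun k => P (k + (i + 1)) i := by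
      refine cauchySeq_of_le_geometric (1 / 2) 1 (by norm_num) fun k => ?_
      rw [dist_comm, dist_eq_norm, one_mul]
      have hi : i < n (k + (i + 1)) := (hlt i).trans_le (hn.monotone (Nat.le_add_left (i + 1) k))
      have h1 := hP_succ (k + (i + 1)) i hi
      have h2 : (1 / 2 : ℝ) ^ (k + (i + 1) + 1) ≤ (1 / 2) ^ k :=
        pow_le_pow_of_le_one (by norm_num) (by norm_num)
          (show k ≤ k + (i + 1) + 1 by omega)
      rw [show k + 1 + (i + 1) = k + (i + 1) + 1 by ring]
      exact h1.trans h2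
    obtain ⟨p, hp⟩ := cauchySeq_tendsto_of_complete hc
    exact ⟨p, (tendsto_add_atTop_iff_nat (i + 1)).1 hp⟩
  choose p hp using hPlim
  have hpproj : ∀ i, IsStarProjection (p i) := fun i =>
    isStarProjection_of_tendsto (fun k => (hst k).isStarProjection i) (hp i)
  have hpfin : ∀ i, FiniteDimensional ℂ (p i).range := by
    intro i
    have h1 := ((hp i).const_sub (p i)).norm
    rw [sub_self, norm_zero] at h1
    obtain ⟨k, hk⟩ := (h1.eventually_lt_const one_pos).exists
    exact finiteDimensional_range_of_norm_sub_lt_one (hpproj i) ((hst k).finiteDimensional i) hk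
  -- The finite products converge to the infinite product.
  have hQlim : ∀ z, Tendsto (fun k => partialProduct z₀ (a k) (P k) (n k) z) atTop
      (𝓝 (weierstrassProduct z₀ α p z)) := by
    intro z
    obtain ⟨c, hc, hb⟩ := exists_summable_bound (X := X) hαtop z₀ (dist z z₀)
    have h1 := tendsto_orderedProd_of_dominated hc
      (u := fun k i => elementaryFactor (P k i) (i + 1) ((z - z₀) / (α i - z₀)))
      (v := fun i => elementaryFactor (p i) (i + 1) ((z - z₀) / (α i - z₀))) (m := n)
      (fun k i => hb i z (Metric.mem_closedBall.2 le_rfl) _ ((hst k).isStarProjection i))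
      (fun i => tendsto_elementaryFactor (fun k => ((hst k).isStarProjection i).isIdempotentElem)
        (hpproj i).isIdempotentElem (hp i) _ _) hn.tendsto_atTop
    refine h1.congr fun k => ?_
    rw [partialProduct_eq_orderedProd]
    exact orderedProd_congr fun i hi => by rw [hα k i hi]
  -- The quotients converge.
  have hFlim : ∀ R : ℝ, ∃ H : ℂ → X →L[ℂ] X, DifferentiableOn ℂ H (Metric.ball z₀ R) ∧
      ∀ z ∈ Metric.ball z₀ R, IsUnit (H z) ∧ Tendsto (fun k => F k z) atTop (𝓝 (H z)) := by
    intro R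
    obtain ⟨K, hK⟩ := (hrtop.eventually_ge_atTop R).exists
    have hsub : ∀ k, Metric.ball z₀ R ⊆ Metric.ball z₀ (r (K + k)) := fun k =>
      Metric.ball_subset_ball (hK.trans (hrmono.monotone (Nat.le_add_right K k)))
    have hc : Summable fun k : ℕ => (1 / 2 : ℝ) ^ (K + k + 1) := by
      have := (summable_geometric_of_lt_one (r := (1 / 2 : ℝ)) (by norm_num)
        (by norm_num)).mul_left ((1 / 2) ^ (K + 1))
      refine this.congr fun k => ?_
      rw [← pow_add]; congr 1; ring
    have hSn : ∀ k, ∀ z ∈ Metric.ball z₀ R, ‖S (K + k) z - 1‖ ≤ (1 / 2) ^ (K + k + 1) :=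
      fun k z hz => (hF_succ (K + k) z (Metric.ball_subset_closedBall (hsub k hz))).1
    have hSu : ∀ k, ∀ z ∈ Metric.ball z₀ R, IsUnit (S (K + k) z) := fun k z hz =>
      isUnit_of_norm_sub_one_lt_one ((hSn k z hz).trans_lt
        (pow_lt_one₀ (by norm_num) (by norm_num) (by omega)))
    refine ⟨fun z => F K z * infiniteProd fun k => S (K + k) z,
      (hst K).differentiable.differentiableOn.mul (differentiableOn_infiniteProd Metric.isOpen_ball
        hc hSn fun k => (hS_diff (K + k)).mono (hsub k)), fun z hz => ⟨?_, ?_⟩⟩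
    · exact ((hst K).isUnit z (Metric.ball_subset_closedBall (hsub 0 hz))).mul
        (isUnit_infiniteProd hc (fun k => hSn k z hz) fun k => hSu k z hz)
    · rw [← tendsto_add_atTop_iff_nat K]
      refine ((tendsto_orderedProd hc fun k => hSn k z hz).const_mul (F K z)).congr fun k => ?_
      rw [add_comm k K]
      induction k with
      | zero => simp
      | succ k ih =>
        rw [orderedProd_succ, ← mul_assoc, ih, ← add_assoc]
        exact (hF_succ (K + k) z (Metric.ball_subset_closedBall (hsub k hz))).2.symm
  obtain ⟨H, hHd, hH⟩ := exists_entire_limit hFlim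
  refine ⟨H, weierstrassProduct z₀ α p,
    isWeierstrassProduct_weierstrassProduct hαtop hα₀ hpproj hpfin,
    differentiable_weierstrassProduct hαtop hpproj, hHd, fun z => (hH z).1, fun z => ?_⟩
  exact tendsto_nhds_unique (tendsto_const_nhds.congr fun k => (hst k).eq_mul z)
    ((hH z).2.mul (hQlim z))

end RightFactorization

end OperatorWeierstrass

end

theorem theorem4p2 {X : Type*} [NormedAddCommGroup X] [InnerProductSpace ℂ X] [CompleteSpace X]
    [TopologicalSpace.SeparableSpace X]
    (A : ℂ → X →L[ℂ] X) (hA : Differentiable ℂ A)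
    (hFredholm : ∀ z, (A z).IsFredholm) (z₀ : ℂ) (hz₀ : IsUnit (A z₀)) :
    (∃ P E : ℂ → X →L[ℂ] X,
      OperatorWeierstrass.IsWeierstrassProduct z₀ P ∧ Differentiable ℂ P ∧
      Differentiable ℂ E ∧ (∀ z, IsUnit (E z)) ∧ ∀ z, A z = P z * E z) ∧
    (∃ F Q : ℂ → X →L[ℂ] X,
      OperatorWeierstrass.IsWeierstrassProduct z₀ Q ∧ Differentiable ℂ Q ∧
      Differentiable ℂ F ∧ (∀ z, IsUnit (F z)) ∧ ∀ z, A z = F z * Q z) :=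
  ⟨OperatorWeierstrass.exists_eq_weierstrassProduct_mul hA hFredholm hz₀,
    OperatorWeierstrass.exists_eq_mul_weierstrassProduct hA hFredholm hz₀⟩
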